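/- Let $(\Omega,\mathcal F,\mathbb P)$ be a probability space and $\mathcal G\subseteq\mathcal F$ a sub-$\sigma$-algebra; (in)equalities between random variables are $\mathbb P$-a.s., and $\operatorname{ess\,sup}$, $\operatorname{ess\,inf}$ are the $\mathbb P$-essential supremum and infimum, with values in the extended real random variables. Let $L_{\mathcal F}\subseteq L^0(\Omega,\mathcal F,\mathbb P)$ and $L_{\mathcal G}\subseteq L^0(\Omega,\mathcal G,\mathbb P)$ be vector spaces that are lattices for the a.s. order, with $X\mathbf 1_A\in L_{\mathcal F}$ for $X\in L_{\mathcal F}$, $A\in\mathcal F$ and $Y\mathbf 1_A\in L_{\mathcal G}$ for $Y\in L_{\mathcal G}$, $A\in\mathcal G$. Let $L_{\mathcal F}^*$ be the order continuous dual of $L_{\mathcal F}$. Assume that every order continuous functional is of the form $\xi\mapsto E_{\mathbb P}[g\xi]$ with $g\in L^1(\Omega,\mathcal F,\mathbb P)$ (so that $L_{\mathcal F}^*$ is regarded as a subset of $L^1$), that $g\mathbf 1_A\in L^*_{\mathcal F}$ for $g\in L_{\mathcal F}^*$ and $A\in\mathcal F$, and that $L_{\mathcal F}^*$ separates the points of $L_{\mathcal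 F}$. Assume moreover that $L_{\mathcal G}\subseteq L_{\mathcal F}$ and that $L_{\mathcal G}$ contains the constants. Write $Q\in L_{\mathcal F}^*\cap\mathcal P$ if $Q\ll\mathbb P$ is a probability measure with $\frac{dQ}{d\mathbb P}\in L_{\mathcal F}^*$, and $Q\in L_{\mathcal F}^*\cap\mathcal P_{\mathcal G}$ if in addition $Q=\mathbb P$ on $\mathcal G$. Suppose that $E_Q[\xi|\mathcal G]\in L_{\mathcal F}$ for every $Q\in L_{\mathcal F}^*\cap\mathcal P_{\mathcal G}$ and $\xi\in L_{\mathcal F}$. Let $\pi:L_{\mathcal F}\to L_{\mathcal G}$ be * monotone: $X\le Y\Rightarrow\pi(X)\le\pi(Y)$; * regular: $\pi(X\mathbf 1_A+Y\mathbf 1_{A^c})=\pi(X)\mathbf 1_A+\pi(Y)\mathbf 1_{A^c}$ for $X,Y\in L_{\mathcal F}$, $A\in\mathcal G$; * cash additive: $\pi(X+\Lambda)=\pi(X)+\Lambda$ for $X\in L_{\mathcal F}$, $\Lambda\in L_{\mathcal G}$. For $X\in L_{\mathcal F}$ put $$K(X,Q)=\operatorname*{ess\,inf}_{\xi\in L_{\mathcal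 F}}\{\pi(\xi)\mid E_Q[\xi|\mathcal G]\ge E_Q[X|\mathcal G]\ Q\text{-a.s.}\},\qquad \pi^*(Q)=\operatorname*{ess\,sup}_{\xi\in L_{\mathcal F}}\{E_Q[\xi|\mathcal G]-\pi(\xi)\}.$$ (i) For every $Q\in L_{\mathcal F}^*\cap\mathcal P_{\mathcal G}$ and $X\in L_{\mathcal F}$, $$K(X,Q)=E_Q[X|\mathcal G]-\pi^*(Q).$$ (ii) Suppose in addition that $\pi$ is quasiconvex, i.e. $\pi(\Lambda X+(1-\Lambda)Y)\le\pi(X)\vee\pi(Y)$ for all $X,Y\in L_{\mathcal F}$ and $\mathcal G$-measurable $0\le\Lambda\le1$ (with $\Lambda X+(1-\Lambda)Y\in L_{\mathcal F}$), that $\pi$ is $\sigma(L_{\mathcal F},L_{\mathcal F}^*)$-lower semicontinuous, i.e. $\{X\in L_{\mathcal F}\mid\pi(X)\le Y\}$ is $\sigma(L_{\mathcal F},L_{\mathcal F}^*)$-closed for every $Y\in L_{\mathcal G}$, and that $L_{\mathcal F}^*\cap\mathcal P_{\mathcal G}\neq\emptyset$. Then, for every $X\in L_{\mathcal F}$, $$\pi(X)=\operatorname*{ess\,sup}_{Q\in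 L_{\mathcal F}^*\cap\mathcal P_{\mathcal G}}\{E_Q[X|\mathcal G]-\pi^*(Q)\}.$$ -/

import Mathlib

open MeasureTheory Filter Topology
open scoped ENNReal

universe u

namespace CondQuasiconvex

/-! ## Essential suprema and infima of families of extended real random variables

Extended real random variables are taken modulo `P`-a.e. equality, ordered `P`-a.e.; the essential
supremum (infimum) of a family is its least upper (greatest lower) bound for this order. -/

section Essential

variable {Ω : Type u} {mF : MeasurableSpace Ω} {P : Measure Ω}

/-- A bounded strictly increasing scale on the extended reals. -/
noncomputable def scale (x : EReal) : ℝ≥0∞ :=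
  (ENNReal.orderIsoIicOneBirational (EReal.expOrderIso x) : ℝ≥0∞)

theorem scale_strictMono : StrictMono scale := fun _ _ h =>
  ENNReal.orderIsoIicOneBirational.strictMono (EReal.expOrderIso.strictMono h)

theorem scale_le_one (x : EReal) : scale x ≤ 1 :=
  (ENNReal.orderIsoIicOneBirational (EReal.expOrderIso x)).2

/-- The pointwise supremum of a sequence of extended real random variables. -/
noncomputable def seqSup (s : ℕ → Ω →ₘ[P] EReal) : Ω →ₘ[P] EReal :=
  AEEqFun.mk (fun ω => ⨆ n, s n ω)
    (Measurable.iSup fun n => (s n).measurable).aestronglyMeasurable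

theorem coeFn_seqSup (s : ℕ → Ω →ₘ[P] EReal) : seqSup s =ᵐ[P] fun ω => ⨆ n, s n ω :=
  AEEqFun.coeFn_mk _ _

theorem le_seqSup (s : ℕ → Ω →ₘ[P] EReal) (n : ℕ) : s n ≤ seqSup s := by
  rw [← AEEqFun.coeFn_le]
  filter_upwards [coeFn_seqSup s] with ω h
  rw [h]
  exact le_iSup (fun n => s n ω) n

theorem seqSup_le (s : ℕ → Ω →ₘ[P] EReal) (W : Ω →ₘ[P] EReal) (h : ∀ n, s n ≤ W) :
    seqSup s ≤ W := by
  rw [← AEEqFun.coeFn_le]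
  have h' : ∀ᵐ ω ∂P, ∀ n, s n ω ≤ W ω :=
    ae_all_iff.2 fun n => AEEqFun.coeFn_le.2 (h n)
  filter_upwards [coeFn_seqSup s, h'] with ω h1 h2
  rw [h1]
  exact iSup_le h2

theorem exists_isLUB [IsFiniteMeasure P] (S : Set (Ω →ₘ[P] EReal)) : ∃ Z, IsLUB S Z := by
  rcases S.eq_empty_or_nonempty with rfl | hS
  · refine ⟨AEEqFun.const Ω ⊥, by simp, fun W _ => ?_⟩
    rw [← AEEqFun.coeFn_le]
    filter_upwards [AEEqFun.coeFn_const Ω (⊥ : EReal) (μ := P)] with ω h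
    rw [h]
    exact bot_le
  let J : (Ω →ₘ[P] EReal) → ℝ≥0∞ := fun Z => ∫⁻ ω, scale (Z ω) ∂P
  have hJ : Monotone J := fun Z W h => lintegral_mono_ae <| by
    filter_upwards [AEEqFun.coeFn_le.2 h] with ω hω using scale_strictMono.monotone hω
  have hJfin : ∀ Z, J Z ≠ ∞ := fun Z => ne_of_lt <|
    lt_of_le_of_lt (lintegral_mono fun ω => scale_le_one (Z ω)) (by simp)
  let T : Set ℝ≥0∞ := {c | ∃ s : ℕ → Ω →ₘ[P] EReal, (∀ n, s n ∈ S) ∧ c = J (seqSup s)}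
  have hT : T.Nonempty := by
    obtain ⟨f, hf⟩ := hS
    exact ⟨_, fun _ => f, fun _ => hf, rfl⟩
  obtain ⟨c, -, hc, hcT⟩ := exists_seq_tendsto_sSup hT (OrderTop.bddAbove T)
  choose t ht hct using hcT
  let s : ℕ → Ω →ₘ[P] EReal := fun n => t n.unpair.1 n.unpair.2
  have hs : ∀ n, s n ∈ S := fun n => ht _ _
  have hts : ∀ k, seqSup (t k) ≤ seqSup s := fun k => seqSup_le _ _ fun n => by
    have := le_seqSup s (Nat.pair k n)
    simpa [s] using this
  have hsup : sSup T ≤ J (seqSup s) :=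
    le_of_tendsto' hc fun k => by rw [hct]; exact hJ (hts k)
  refine ⟨seqSup s, fun f hf => ?_, fun W hW => seqSup_le _ _ fun n => hW (hs n)⟩
  let s' : ℕ → Ω →ₘ[P] EReal := fun n => Nat.casesOn n f s
  have hs' : ∀ n, s' n ∈ S := fun n => by cases n with
    | zero => exact hf
    | succ k => exact hs k
  have hle : seqSup s ≤ seqSup s' := seqSup_le _ _ fun n => le_seqSup s' (n + 1)
  have hJle : J (seqSup s') ≤ J (seqSup s) := le_trans (le_sSup (show J (seqSup s') ∈ T from ⟨s', hs', rfl⟩)) hsup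
  have hae : (fun ω => scale (seqSup s ω)) =ᵐ[P] fun ω => scale (seqSup s' ω) :=
    ae_eq_of_ae_le_of_lintegral_le
      (by filter_upwards [AEEqFun.coeFn_le.2 hle] with ω h using scale_strictMono.monotone h)
      (hJfin _) (scale_strictMono.monotone.measurable.comp (seqSup s').measurable).aemeasurable
      hJle
  refine le_trans (le_seqSup s' 0) ?_
  rw [← AEEqFun.coeFn_le]
  filter_upwards [hae] with ω h
  exact (scale_strictMono.injective h).ge

/-- The essential supremum of a family of extended real random variables. -/
noncomputable def aeSup [IsFiniteMeasure P] (S : Set (Ω →ₘ[P] EReal)) : Ω →ₘ[P] EReal :=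
  (exists_isLUB S).choose

theorem isLUB_aeSup [IsFiniteMeasure P] (S : Set (Ω →ₘ[P] EReal)) : IsLUB S (aeSup S) :=
  (exists_isLUB S).choose_spec

/-- The essential infimum of a family of extended real random variables. -/
noncomputable def aeInf [IsFiniteMeasure P] (S : Set (Ω →ₘ[P] EReal)) : Ω →ₘ[P] EReal :=
  aeSup (lowerBounds S)

theorem isGLB_aeInf [IsFiniteMeasure P] (S : Set (Ω →ₘ[P] EReal)) : IsGLB S (aeInf S) :=
  isLUB_lowerBounds.1 (isLUB_aeSup (lowerBounds S))

/-- A finite random variable regarded as an extended real one. -/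
noncomputable def toExt (X : Ω →ₘ[P] ℝ) : Ω →ₘ[P] EReal :=
  AEEqFun.comp Real.toEReal continuous_coe_real_ereal X

theorem continuous_coe_sub : Continuous (Function.uncurry fun (x : ℝ) (y : EReal) => (x : EReal) - y) := by
  rw [continuous_iff_continuousAt]
  rintro ⟨x, y⟩
  have h : ContinuousAt (fun p : EReal × EReal => p.1 + p.2) ((x : EReal), -y) :=
    EReal.continuousAt_add (Or.inl (EReal.coe_ne_top x)) (Or.inl (EReal.coe_ne_bot x))
  have h2 : Continuous fun p : ℝ × EReal => ((p.1 : EReal), -p.2) :=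
    (continuous_coe_real_ereal.comp continuous_fst).prodMk (continuous_neg.comp continuous_snd)
  exact ContinuousAt.comp (x := (x, y)) h h2.continuousAt

/-- `X - Z` for a finite random variable `X` and an extended real random variable `Z`. -/
noncomputable def extSub (X : Ω →ₘ[P] ℝ) (Z : Ω →ₘ[P] EReal) : Ω →ₘ[P] EReal :=
  AEEqFun.comp₂ (fun (x : ℝ) (y : EReal) => (x : EReal) - y) continuous_coe_sub X Z

end Essential

/-! ## Order continuous dual -/

section OrderDual

/-- The net `x` order converges to `0`: `|x i| ≤ y i` for some net `y` decreasing to `0`. -/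
def OrderTendstoZero {E : Type u} [AddCommGroup E] [PartialOrder E] {ι : Type u} [Preorder ι]
    (x : ι → E) : Prop :=
  ∃ y : ι → E, Antitone y ∧ IsGLB (Set.range y) 0 ∧ ∀ i, -(y i) ≤ x i ∧ x i ≤ y i

/-- Order continuous linear functionals: order null nets are mapped to null nets. -/
def IsOrderContinuous {E : Type u} [AddCommGroup E] [PartialOrder E] [Module ℝ E]
    (φ : E →ₗ[ℝ] ℝ) : Prop :=
  ∀ (ι : Type u) [Preorder ι] [IsDirectedOrder ι] [Nonempty ι] (x : ι → E),
    OrderTendstoZero x → Tendsto (fun i => φ (x i)) atTop (𝓝 0)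

variable {Ω : Type u} {mF : MeasurableSpace Ω} {P : Measure Ω}

/-- `g ∈ L¹(P)` represents the functional `φ` on `L`: `φ(ξ) = E_P[g ξ]` for all `ξ ∈ L`. -/
def Represents (L : Submodule ℝ (Ω →ₘ[P] ℝ)) (g : Ω →ₘ[P] ℝ) (φ : L →ₗ[ℝ] ℝ) : Prop :=
  Integrable g P ∧ ∀ ξ : L, Integrable (fun ω => g ω * (ξ : Ω →ₘ[P] ℝ) ω) P ∧
    φ ξ = ∫ ω, g ω * (ξ : Ω →ₘ[P] ℝ) ω ∂P

/-- The order continuous dual of `L`, as a set of `P`-integrable densities. -/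
def orderDual (L : Submodule ℝ (Ω →ₘ[P] ℝ)) : Set (Ω →ₘ[P] ℝ) :=
  {g | ∃ φ : L →ₗ[ℝ] ℝ, IsOrderContinuous φ ∧ Represents L g φ}

/-- The weak topology `σ(L, L*)` on `L`. -/
@[reducible] noncomputable def weakTopology (L : Submodule ℝ (Ω →ₘ[P] ℝ)) : TopologicalSpace L :=
  TopologicalSpace.induced
    (fun (ξ : L) (g : orderDual L) => ∫ ω, (g : Ω →ₘ[P] ℝ) ω * (ξ : Ω →ₘ[P] ℝ) ω ∂P)
    Pi.topologicalSpace

end OrderDual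

/-! ## The spaces, the probabilities and the maps -/

section Setting

variable {Ω : Type u} {mG mF : MeasurableSpace Ω} {P : Measure Ω}

/-- The (class of the) indicator function of a measurable set. -/
noncomputable def ind (P : Measure Ω) {A : Set Ω} (hA : MeasurableSet A) : Ω →ₘ[P] ℝ :=
  AEEqFun.mk (A.indicator fun _ => (1 : ℝ))
    (measurable_const.indicator hA).aestronglyMeasurable

/-- The assumptions on the spaces `L_F = LF` and `L_G = LG`. -/
structure Admissible (hm : mG ≤ mF) (LF LG : Submodule ℝ (Ω →ₘ[P] ℝ)) : Prop where
  /-- `L_F` and `L_G` are lattices for the `P`-a.s. order. -/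
  sup_memF : ∀ X ∈ LF, ∀ Y ∈ LF, X ⊔ Y ∈ LF
  inf_memF : ∀ X ∈ LF, ∀ Y ∈ LF, X ⊓ Y ∈ LF
  sup_memG : ∀ X ∈ LG, ∀ Y ∈ LG, X ⊔ Y ∈ LG
  inf_memG : ∀ X ∈ LG, ∀ Y ∈ LG, X ⊓ Y ∈ LG
  /-- The elements of `L_G` are `G`-measurable. -/
  measurableG : ∀ Y ∈ LG, AEStronglyMeasurable[mG] Y P
  /-- `L_F` and `L_G` are stable under multiplication by indicators of events of `F`, resp. `G`. -/
  ind_memF : ∀ X ∈ LF, ∀ (A : Set Ω) (hA : MeasurableSet[mF] A), X * ind P hA ∈ LF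
  ind_memG : ∀ Y ∈ LG, ∀ (A : Set Ω) (hA : MeasurableSet[mG] A), Y * ind P (hm A hA) ∈ LG
  /-- The order continuous dual of `L_F` is contained in `L¹(P)`... -/
  dual_repr : ∀ φ : LF →ₗ[ℝ] ℝ, IsOrderContinuous φ → ∃ g, Represents LF g φ
  /-- ... and stable under multiplication by indicators of events of `F`. -/
  ind_memDual : ∀ g ∈ orderDual LF, ∀ (A : Set Ω) (hA : MeasurableSet[mF] A),
    g * ind P hA ∈ orderDual LF
  /-- The order continuous dual separates the points of `L_F`, that is, `σ(L_F, L_F*)` is a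
  (Hausdorff) locally convex topology. -/
  separates : ∀ ξ ∈ LF, (∀ g ∈ orderDual LF, ∫ ω, g ω * ξ ω ∂P = 0) → ξ = 0

/-- The density `dQ/dP`. -/
noncomputable def density (P Q : Measure Ω) : Ω →ₘ[P] ℝ :=
  AEEqFun.mk (fun ω => (Q.rnDeriv P ω).toReal)
    (Measure.measurable_rnDeriv Q P).ennreal_toReal.aestronglyMeasurable

/-- The probabilities `Q ≪ P` with `dQ/dP ∈ L*`. -/
def dualProb (L : Submodule ℝ (Ω →ₘ[P] ℝ)) : Set (Measure Ω) :=
  {Q | IsProbabilityMeasure Q ∧ Q ≪ P ∧ density P Q ∈ orderDual L}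

/-- The probabilities `Q ≪ P` with `Q = P` on `G`. -/
def probAgreeing (mG : MeasurableSpace Ω) {mF : MeasurableSpace Ω} (P : Measure Ω) :
    Set (Measure Ω) :=
  {Q | IsProbabilityMeasure Q ∧ Q ≪ P ∧ ∀ A : Set Ω, MeasurableSet[mG] A → Q A = P A}

/-- The conditional expectation `E_Q[X | G]` as a class modulo `P` (used for `Q = P` on `G`, where
it is determined `P`-a.s.). -/
noncomputable def condE (hm : mG ≤ mF) (Q : Measure Ω) (X : Ω →ₘ[P] ℝ) : Ω →ₘ[P] ℝ :=
  AEEqFun.mk (condExp mG Q X) (stronglyMeasurable_condExp.mono hm).aestronglyMeasurable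

variable {LF LG : Submodule ℝ (Ω →ₘ[P] ℝ)}

/-- (QCO), for those conditional convex combinations that lie in the domain. -/
def IsQuasiconvex (mG : MeasurableSpace Ω) {mF : MeasurableSpace Ω} {P : Measure Ω}
    {LF LG : Submodule ℝ (Ω →ₘ[P] ℝ)} (π : LF → LG) : Prop :=
  ∀ (X Y Z : LF) (Λ : Ω →ₘ[P] ℝ), AEStronglyMeasurable[mG] Λ P → 0 ≤ Λ → Λ ≤ 1 →
    (Z : Ω →ₘ[P] ℝ) = Λ * (X : Ω →ₘ[P] ℝ) + (1 - Λ) * (Y : Ω →ₘ[P] ℝ) →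
    (π Z : Ω →ₘ[P] ℝ) ≤ (π X : Ω →ₘ[P] ℝ) ⊔ (π Y : Ω →ₘ[P] ℝ)

/-- (REG). -/
def IsRegularMap (hm : mG ≤ mF) (π : LF → LG) : Prop :=
  ∀ (X Y Z : LF) (A : Set Ω) (hA : MeasurableSet[mG] A),
    (Z : Ω →ₘ[P] ℝ) = (X : Ω →ₘ[P] ℝ) * ind P (hm A hA) + (Y : Ω →ₘ[P] ℝ) * ind P (hm A hA).compl →
    (π Z : Ω →ₘ[P] ℝ) =
      (π X : Ω →ₘ[P] ℝ) * ind P (hm A hA) + (π Y : Ω →ₘ[P] ℝ) * ind P (hm A hA).compl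

/-- (LSC) with respect to `σ(L_F, L_F*)`. -/
def IsWeakLSC (π : LF → LG) : Prop :=
  ∀ Y : LG, IsClosed[weakTopology LF] {X : LF | π X ≤ Y}

/-- (CAS). -/
def IsCashAdditive (π : LF → LG) : Prop :=
  ∀ (X Z : LF) (Λ : LG), (Z : Ω →ₘ[P] ℝ) = (X : Ω →ₘ[P] ℝ) + (Λ : Ω →ₘ[P] ℝ) →
    (π Z : Ω →ₘ[P] ℝ) = (π X : Ω →ₘ[P] ℝ) + (Λ : Ω →ₘ[P] ℝ)

/-- `K(X, Q) = ess inf {π(ξ) | ξ ∈ L_F, E_Q[ξ | G] ≥ E_Q[X | G] Q-a.s.}`. -/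
noncomputable def K (mG : MeasurableSpace Ω) {mF : MeasurableSpace Ω} {P : Measure Ω}
    [IsFiniteMeasure P] {LF LG : Submodule ℝ (Ω →ₘ[P] ℝ)} (π : LF → LG) (X : LF)
    (Q : Measure Ω) : Ω →ₘ[P] EReal :=
  aeInf {Z | ∃ ξ : LF, condExp mG Q (X : Ω →ₘ[P] ℝ) ≤ᵐ[Q] condExp mG Q (ξ : Ω →ₘ[P] ℝ) ∧
    Z = toExt (π ξ : Ω →ₘ[P] ℝ)}

/-- The conditional Fenchel conjugate `π*(Q) = ess sup {E_Q[ξ | G] - π(ξ) | ξ ∈ L_F}`. -/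
noncomputable def conjugate [IsFiniteMeasure P] (hm : mG ≤ mF) (π : LF → LG) (Q : Measure Ω) :
    Ω →ₘ[P] EReal :=
  aeSup {Z | ∃ ξ : LF, Z = toExt (condE hm Q (ξ : Ω →ₘ[P] ℝ) - (π ξ : Ω →ₘ[P] ℝ))}

end Setting

end CondQuasiconvex

/-! Cash additivity moves every `X` to level zero through `X - π(X)`, so `π` is encoded in its
acceptance set `{π ≤ 0}`.

(i) If `E_Q[ξ|G] ≥ E_Q[X|G]`, then `π(ξ) ≥ E_Q[ξ|G] - π*(Q) ≥ E_Q[X|G] - π*(Q)`. Conversely,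
shifting an arbitrary `ξ` by `E_Q[X|G] - E_Q[ξ|G]` produces a competitor for `K(X,Q)`, whence
`K(X,Q) ≤ E_Q[X|G] - (E_Q[ξ|G] - π(ξ))`. The shift is `G`-measurable and in `L_F`, but perhaps not
in `L_G`; `map_eq_add_of_eq_add` extends cash additivity to such shifts.

(ii) The inequality `≥` is the definition of `π*`. For `≤`, the acceptance set is convex and weakly
closed, so Hahn-Banach separates a rejected point from it by a density `g`
(`exists_separating_density`). This compares expectations only; since regularity makes the set
stable under `G`-pasting, an exhaustion argument turns it into a strict inequality of conditional
expectations on a nonnull `G`-event (`exists_separating_event`). Monotonicity forces `g ≥ 0`, and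
dividing `g` by `E_P[g|G]` where this is bounded below yields a probability agreeing with `P` on `G`
(`exists_normalized`). Thus inside every nonnull `G`-event there is a nonnull piece on which some
`Q` satisfies `π*(Q) ≤ E_Q[X|G] - π(X) + ε` (`exists_almost_optimal`), so the supremum cannot lie
below `π(X) - ε` on a nonnull set. -/

namespace CondQuasiconvex

/-! ### Order continuous densities and weak separation -/

section Dual

variable {Ω : Type u} {mF : MeasurableSpace Ω} {P : Measure Ω} {L : Submodule ℝ (Ω →ₘ[P] ℝ)}

theorem coeFn_ind {A : Set Ω} (hA : MeasurableSet A) :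
    ind P hA =ᵐ[P] A.indicator fun _ => (1 : ℝ) :=
  AEEqFun.coeFn_mk _ _

theorem coeFn_mul_ind (X : Ω →ₘ[P] ℝ) {A : Set Ω} (hA : MeasurableSet A) :
    (X * ind P hA : Ω →ₘ[P] ℝ) =ᵐ[P] A.indicator X := by
  filter_upwards [AEEqFun.coeFn_mul X (ind P hA), coeFn_ind (P := P) hA] with ω h1 h2
  rw [h1, Pi.mul_apply, h2]
  by_cases h : ω ∈ A <;> simp [h]

/-- The functional `ξ ↦ E_P[g ξ]`. -/
noncomputable def integralFunctional (L : Submodule ℝ (Ω →ₘ[P] ℝ)) (g : Ω →ₘ[P] ℝ)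
    (hg : ∀ ξ : L, Integrable (fun ω => g ω * (ξ : Ω →ₘ[P] ℝ) ω) P) : L →ₗ[ℝ] ℝ where
  toFun ξ := ∫ ω, g ω * (ξ : Ω →ₘ[P] ℝ) ω ∂P
  map_add' ξ η := by
    rw [← integral_add (hg ξ) (hg η)]
    refine integral_congr_ae ?_
    filter_upwards [AEEqFun.coeFn_add (ξ : Ω →ₘ[P] ℝ) η] with ω h
    simp only [Submodule.coe_add, h, Pi.add_apply, mul_add]
  map_smul' c ξ := by
    rw [RingHom.id_apply, smul_eq_mul, ← integral_const_mul]
    refine integral_congr_ae ?_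
    filter_upwards [AEEqFun.coeFn_smul c (ξ : Ω →ₘ[P] ℝ)] with ω h
    simp only [Submodule.coe_smul, h, Pi.smul_apply, smul_eq_mul]
    ring

/-- The functional is determined by its density, so the existential over functionals can be dropped
and closure properties checked on densities. -/
theorem mem_orderDual_iff {g : Ω →ₘ[P] ℝ} :
    g ∈ orderDual L ↔ Integrable g P ∧
      (∀ ξ : L, Integrable (fun ω => g ω * (ξ : Ω →ₘ[P] ℝ) ω) P) ∧
      ∀ (ι : Type u) [Preorder ι] [IsDirectedOrder ι] [Nonempty ι] (x : ι → L),
        OrderTendstoZero x →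
          Tendsto (fun i => ∫ ω, g ω * (x i : Ω →ₘ[P] ℝ) ω ∂P) atTop (𝓝 0) := by
  constructor
  · rintro ⟨φ, hφ, hg, hr⟩
    refine ⟨hg, fun ξ => (hr ξ).1, fun ι _ _ _ x hx => ?_⟩
    simpa only [(hr _).2] using hφ ι x hx
  · rintro ⟨hg, hi, hc⟩
    exact ⟨integralFunctional L g hi, fun ι _ _ _ x hx => hc ι x hx, hg,
      fun ξ => ⟨hi ξ, rfl⟩⟩

theorem integrable_mul_of_mem_orderDual {g ξ : Ω →ₘ[P] ℝ} (hg : g ∈ orderDual L) (hξ : ξ ∈ L) :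
    Integrable (fun ω => g ω * ξ ω) P :=
  (mem_orderDual_iff.1 hg).2.1 ⟨ξ, hξ⟩

theorem add_mem_orderDual {g h : Ω →ₘ[P] ℝ} (hg : g ∈ orderDual L) (hh : h ∈ orderDual L) :
    g + h ∈ orderDual L := by
  rw [mem_orderDual_iff] at *
  have e : ∀ ξ : L, (fun ω => (g + h : Ω →ₘ[P] ℝ) ω * (ξ : Ω →ₘ[P] ℝ) ω) =ᵐ[P]
      fun ω => g ω * (ξ : Ω →ₘ[P] ℝ) ω + h ω * (ξ : Ω →ₘ[P] ℝ) ω := fun ξ => by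
    filter_upwards [AEEqFun.coeFn_add g h] with ω hω
    rw [hω, Pi.add_apply, add_mul]
  refine ⟨(hg.1.add hh.1).congr (AEEqFun.coeFn_add g h).symm,
    fun ξ => ((hg.2.1 ξ).add (hh.2.1 ξ)).congr (e ξ).symm, fun ι _ _ _ x hx => ?_⟩
  have := (hg.2.2 ι x hx).add (hh.2.2 ι x hx)
  rw [add_zero] at this
  refine this.congr fun i => ?_
  rw [integral_congr_ae (e (x i)), integral_add (hg.2.1 _) (hh.2.1 _)]

theorem smul_mem_orderDual (c : ℝ) {g : Ω →ₘ[P] ℝ} (hg : g ∈ orderDual L) :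
    c • g ∈ orderDual L := by
  rw [mem_orderDual_iff] at *
  have e : ∀ ξ : L, (fun ω => (c • g : Ω →ₘ[P] ℝ) ω * (ξ : Ω →ₘ[P] ℝ) ω) =ᵐ[P]
      fun ω => c * (g ω * (ξ : Ω →ₘ[P] ℝ) ω) := fun ξ => by
    filter_upwards [AEEqFun.coeFn_smul c g] with ω hω
    rw [hω, Pi.smul_apply, smul_eq_mul, mul_assoc]
  refine ⟨(hg.1.smul c).congr (AEEqFun.coeFn_smul c g).symm,
    fun ξ => ((hg.2.1 ξ).const_mul c).congr (e ξ).symm, fun ι _ _ _ x hx => ?_⟩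
  have := (hg.2.2 ι x hx).const_mul c
  rw [mul_zero] at this
  refine this.congr fun i => ?_
  rw [integral_congr_ae (e (x i)), integral_const_mul]

theorem zero_mem_orderDual : (0 : Ω →ₘ[P] ℝ) ∈ orderDual L := by
  have e : ∀ ξ : L, (fun ω => (0 : Ω →ₘ[P] ℝ) ω * (ξ : Ω →ₘ[P] ℝ) ω) =ᵐ[P] fun _ => (0 : ℝ) :=
    fun ξ => by
      filter_upwards [AEEqFun.coeFn_zero (α := Ω) (β := ℝ) (μ := P)] with ω hω
      rw [hω, Pi.zero_apply, zero_mul]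
  rw [mem_orderDual_iff]
  refine ⟨(integrable_zero Ω ℝ P).congr AEEqFun.coeFn_zero.symm,
    fun ξ => (integrable_zero Ω ℝ P).congr (e ξ).symm, fun ι _ _ _ x _ => ?_⟩
  refine tendsto_const_nhds.congr fun i => ?_
  rw [integral_congr_ae (e (x i)), integral_zero]

/-- The order continuous dual is solid: it contains `h` once it contains a nonnegative `g ≥ |h|`. -/
theorem mem_orderDual_of_abs_le {g h : Ω →ₘ[P] ℝ} (hg : g ∈ orderDual L)
    (hle : ∀ᵐ ω ∂P, |h ω| ≤ g ω) : h ∈ orderDual L := by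
  rw [mem_orderDual_iff] at *
  have hi : ∀ ξ : L, Integrable (fun ω => h ω * (ξ : Ω →ₘ[P] ℝ) ω) P := fun ξ => by
    refine (hg.2.1 ξ).mono (h.aestronglyMeasurable.mul (AEEqFun.aestronglyMeasurable _)) ?_
    filter_upwards [hle] with ω hω
    rw [norm_mul, norm_mul]
    gcongr
    exact hω.trans (le_abs_self _)
  refine ⟨hg.1.mono h.aestronglyMeasurable ?_, hi, fun ι _ _ _ x hx => ?_⟩
  · filter_upwards [hle] with ω hω
    exact hω.trans (le_abs_self _)
  obtain ⟨y, hy, hglb, hxy⟩ := hx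
  have hy0 : ∀ i, 0 ≤ y i := fun i => hglb.1 ⟨i, rfl⟩
  -- The dominating net `y` is itself order null, so the order continuity of `g` applies to it.
  have hneg : ∀ i, -(y i) ≤ y i := fun i => by
    have h0 : (0 : Ω →ₘ[P] ℝ) ≤ y i := hy0 i
    change ((-(y i) : L) : Ω →ₘ[P] ℝ) ≤ y i
    rw [Submodule.coe_neg, ← AEEqFun.coeFn_le]
    filter_upwards [AEEqFun.coeFn_le.2 h0, AEEqFun.coeFn_neg (y i : Ω →ₘ[P] ℝ),
      AEEqFun.coeFn_zero (α := Ω) (β := ℝ) (μ := P)] with ω h1 h2 h3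
    rw [h3, Pi.zero_apply] at h1
    rw [h2, Pi.neg_apply]
    linarith
  have key := hg.2.2 ι y ⟨y, hy, hglb, fun i => ⟨hneg i, le_rfl⟩⟩
  refine squeeze_zero_norm (fun i => ?_) key
  refine norm_integral_le_of_norm_le (hg.2.1 _) ?_
  filter_upwards [hle, AEEqFun.coeFn_le.2 (hxy i).1, AEEqFun.coeFn_le.2 (hxy i).2,
    AEEqFun.coeFn_neg (y i : Ω →ₘ[P] ℝ)] with ω h1 h2 h3 h4
  rw [Submodule.coe_neg, h4, Pi.neg_apply] at h2
  rw [norm_mul]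
  exact mul_le_mul h1 (abs_le.2 ⟨h2, h3⟩) (abs_nonneg _) ((abs_nonneg _).trans h1)

/-- Hahn-Banach separation of a point from a closed convex set for `σ(L, L*)`. -/
theorem exists_separating_density {C : Set L} (hC : Convex ℝ C) (hcl : IsClosed[weakTopology L] C)
    {x : L} (hx : x ∉ C) :
    ∃ g ∈ orderDual L, ∃ s : ℝ,
      (∀ ξ ∈ C, ∫ ω, g ω * (ξ : Ω →ₘ[P] ℝ) ω ∂P < s) ∧
        s < ∫ ω, g ω * (x : Ω →ₘ[P] ℝ) ω ∂P := by
  let D : Submodule ℝ (Ω →ₘ[P] ℝ) :=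
    { carrier := orderDual L
      add_mem' := add_mem_orderDual
      zero_mem' := zero_mem_orderDual
      smul_mem' := fun c _ hg => smul_mem_orderDual c hg }
  have hint : ∀ (g : D) (ξ : L), Integrable (fun ω => (g : Ω →ₘ[P] ℝ) ω * (ξ : Ω →ₘ[P] ℝ) ω) P :=
    fun g ξ => integrable_mul_of_mem_orderDual g.2 ξ.2
  let B : L →ₗ[ℝ] D →ₗ[ℝ] ℝ := LinearMap.flip
    { toFun := fun g => integralFunctional L g (hint g)
      map_add' := fun g h => by
        ext ξ
        refine Eq.trans (integral_congr_ae ?_) (integral_add (hint g ξ) (hint h ξ))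
        filter_upwards [AEEqFun.coeFn_add (g : Ω →ₘ[P] ℝ) h] with ω hω
        rw [Submodule.coe_add, hω, Pi.add_apply, add_mul]
      map_smul' := fun c g => by
        ext ξ
        refine Eq.trans (integral_congr_ae ?_) (integral_const_mul c _)
        filter_upwards [AEEqFun.coeFn_smul c (g : Ω →ₘ[P] ℝ)] with ω hω
        rw [Submodule.coe_smul, hω, Pi.smul_apply, smul_eq_mul, mul_assoc] }
  -- Both topologies are induced by the same pairings, so they coincide definitionally.
  have hcl' : IsClosed (X := WeakBilin B) C := hcl
  obtain ⟨f, s, hf, hs⟩ := geometric_hahn_banach_closed_point (E := WeakBilin B) hC hcl' hx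
  -- Every weakly continuous functional is the pairing with some element of `D`.
  obtain ⟨g, rfl⟩ := LinearMap.dualEmbedding_surjective B f
  exact ⟨g, g.2, s, hf, hs⟩

end Dual

/-! ### Probabilities agreeing with `P` on `G` -/

section Agreeing

variable {Ω : Type u} {mG mF : MeasurableSpace Ω} {P Q : Measure Ω}

theorem trim_eq_of_mem_probAgreeing (hm : mG ≤ mF) (hQ : Q ∈ probAgreeing mG P) :
    Q.trim hm = P.trim hm := by
  refine @Measure.ext _ mG _ _ fun A hA => ?_
  rw [trim_measurableSet_eq hm hA, trim_measurableSet_eq hm hA, hQ.2.2 A hA]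

theorem coeFn_density : density P Q =ᵐ[P] fun ω => (Q.rnDeriv P ω).toReal :=
  AEEqFun.coeFn_mk _ _

theorem coeFn_condE (hm : mG ≤ mF) (Q : Measure Ω) (X : Ω →ₘ[P] ℝ) :
    condE hm Q X =ᵐ[P] condExp mG Q X :=
  AEEqFun.coeFn_mk _ _

/-- The exceptional set is a `G`-event, and `Q` and `P` give it the same mass. -/
theorem ae_le_of_ae_le_agreeing (hm : mG ≤ mF) (hQ : Q ∈ probAgreeing mG P) {f g : Ω → ℝ}
    (hf : StronglyMeasurable[mG] f) (hg : StronglyMeasurable[mG] g) (h : f ≤ᵐ[Q] g) :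
    f ≤ᵐ[P] g := by
  have := hf.ae_le_trim_of_stronglyMeasurable hm hg h
  rw [trim_eq_of_mem_probAgreeing hm hQ] at this
  exact ae_le_of_ae_le_trim this

variable [IsProbabilityMeasure P]

theorem integrable_iff_density_mul (hQ : Q ∈ probAgreeing mG P) {f : Ω → ℝ} :
    Integrable f Q ↔ Integrable (fun ω => density P Q ω * f ω) P := by
  have := hQ.1
  rw [← integrable_toReal_rnDeriv_mul_iff hQ.2.1]
  refine integrable_congr ?_
  filter_upwards [coeFn_density (P := P) (Q := Q)] with ω h
  rw [h]

/-- This is the Bayes formula; its denominator `E_P[dQ/dP|G]` is `1` because `Q = P` on `G`. -/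
theorem condExp_agreeing (hm : mG ≤ mF) (hQ : Q ∈ probAgreeing mG P) {f : Ω → ℝ}
    (hf : Integrable (fun ω => density P Q ω * f ω) P) :
    condExp mG Q f =ᵐ[P] condExp mG P (fun ω => density P Q ω * f ω) := by
  have := hQ.1
  have hfQ := (integrable_iff_density_mul hQ).2 hf
  have htrim := trim_eq_of_mem_probAgreeing hm hQ
  have hsm : StronglyMeasurable[mG] (condExp mG Q f) := stronglyMeasurable_condExp
  have hi : Integrable (condExp mG Q f) P := by
    refine integrable_of_integrable_trim hm ?_
    rw [← htrim]
    exact integrable_condExp.trim hm hsm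
  refine ae_eq_condExp_of_forall_setIntegral_eq hm hf (fun _ _ _ => hi.integrableOn)
    (fun A hA _ => ?_) hsm.aestronglyMeasurable
  rw [setIntegral_trim hm hsm hA, ← htrim, ← setIntegral_trim hm hsm hA,
    setIntegral_condExp hm hfQ hA, ← setIntegral_toReal_rnDeriv_mul hQ.2.1 (hm A hA)]
  refine setIntegral_congr_ae (hm A hA) ?_
  filter_upwards [coeFn_density (P := P) (Q := Q)] with ω h _
  rw [h]

theorem condE_ae_eq (hm : mG ≤ mF) (hQ : Q ∈ probAgreeing mG P) {X : Ω →ₘ[P] ℝ}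
    (hX : Integrable (fun ω => density P Q ω * X ω) P) :
    condE hm Q X =ᵐ[P] condExp mG P (fun ω => density P Q ω * X ω) :=
  (AEEqFun.coeFn_mk _ _).trans (condExp_agreeing hm hQ hX)

theorem condE_add (hm : mG ≤ mF) (hQ : Q ∈ probAgreeing mG P) {X Y : Ω →ₘ[P] ℝ}
    (hX : Integrable (fun ω => density P Q ω * X ω) P)
    (hY : Integrable (fun ω => density P Q ω * Y ω) P) :
    condE hm Q (X + Y) =ᵐ[P] fun ω => condE hm Q X ω + condE hm Q Y ω := by
  have e : (fun ω => density P Q ω * (X + Y : Ω →ₘ[P] ℝ) ω) =ᵐ[P]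
      (fun ω => density P Q ω * X ω) + fun ω => density P Q ω * Y ω := by
    filter_upwards [AEEqFun.coeFn_add X Y] with ω h
    rw [h, Pi.add_apply, Pi.add_apply, mul_add]
  have hXY := (hX.add hY).congr e.symm
  filter_upwards [condE_ae_eq hm hQ hXY, condE_ae_eq hm hQ hX, condE_ae_eq hm hQ hY,
    condExp_congr_ae (m := mG) e, condExp_add hX hY mG] with ω h1 h2 h3 h4 h5
  rw [h1, h2, h3, h4, h5, Pi.add_apply]

theorem condExp_density (hm : mG ≤ mF) (hQ : Q ∈ probAgreeing mG P)
    (hi : Integrable (density P Q) P) : condExp mG P (density P Q) =ᵐ[P] fun _ => (1 : ℝ) := by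
  have := hQ.1
  have h := condExp_agreeing hm hQ (f := fun _ => (1 : ℝ)) (by simpa using hi)
  rw [condExp_const hm] at h
  simpa using h.symm

theorem condE_of_measurable (hm : mG ≤ mF) (hQ : Q ∈ probAgreeing mG P)
    (hi : Integrable (density P Q) P) {Λ : Ω →ₘ[P] ℝ} (hΛ : AEStronglyMeasurable[mG] Λ P)
    (hint : Integrable (fun ω => density P Q ω * Λ ω) P) : condE hm Q Λ =ᵐ[P] Λ := by
  filter_upwards [condE_ae_eq hm hQ hint, condExp_density hm hQ hi,
    condExp_mul_of_aestronglyMeasurable_right hΛ hint hi] with ω h1 h2 h3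
  rw [h1]
  refine h3.trans ?_
  rw [Pi.mul_apply, h2, one_mul]

end Agreeing

/-- Finiteness of `a` suffices, even for infinite `z`. It allows a bound on `π*(Q)` to be turned
into one on `K(X,Q)`. -/
theorem coe_sub_coe_sub (a : ℝ) (z : EReal) : (a : EReal) - ((a : EReal) - z) = z := by
  induction z with
  | bot => simp
  | top => simp
  | coe z => norm_cast; ring

/-! ### Locality, extended cash additivity and the formula for `K` -/

section Maps

variable {Ω : Type u} {mG mF : MeasurableSpace Ω} {P : Measure Ω}
  {hm : mG ≤ mF} {LF LG : Submodule ℝ (Ω →ₘ[P] ℝ)} {π : LF → LG}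

/-- Conditional monotonicity of monotone regular maps. -/
theorem map_le_of_le_on (hL : Admissible hm LF LG) (hmon : Monotone π) (hreg : IsRegularMap hm π)
    {X Y : LF} {A : Set Ω} (hA : MeasurableSet[mG] A)
    (h : ∀ᵐ ω ∂P, ω ∈ A → (X : Ω →ₘ[P] ℝ) ω ≤ (Y : Ω →ₘ[P] ℝ) ω) :
    ∀ᵐ ω ∂P, ω ∈ A → (π X : Ω →ₘ[P] ℝ) ω ≤ (π Y : Ω →ₘ[P] ℝ) ω := by
  -- Pasting `Y` outside `A` makes the comparison global; regularity then reads the result back on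
  -- `A`.
  let Z : LF := ⟨X * ind P (hm A hA) + Y * ind P (hm A hA).compl,
    LF.add_mem (hL.ind_memF _ X.2 _ _) (hL.ind_memF _ Y.2 _ _)⟩
  have hZY : Z ≤ Y := by
    change (Z : Ω →ₘ[P] ℝ) ≤ Y
    rw [← AEEqFun.coeFn_le]
    filter_upwards [h, coeFn_mul_ind (X : Ω →ₘ[P] ℝ) (hm A hA),
      coeFn_mul_ind (Y : Ω →ₘ[P] ℝ) (hm A hA).compl, AEEqFun.coeFn_add
        ((X : Ω →ₘ[P] ℝ) * ind P (hm A hA)) (Y * ind P (hm A hA).compl)] with ω h1 h2 h3 h4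
    rw [h4, Pi.add_apply, h2, h3]
    by_cases hω : ω ∈ A
    · simpa [hω] using h1 hω
    · simp [hω]
  have hle : (π Z : Ω →ₘ[P] ℝ) ≤ π Y := hmon hZY
  rw [hreg X Y Z A hA rfl, ← AEEqFun.coeFn_le] at hle
  filter_upwards [hle, coeFn_mul_ind (π X : Ω →ₘ[P] ℝ) (hm A hA),
      coeFn_mul_ind (π Y : Ω →ₘ[P] ℝ) (hm A hA).compl, AEEqFun.coeFn_add
        ((π X : Ω →ₘ[P] ℝ) * ind P (hm A hA)) (π Y * ind P (hm A hA).compl)]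
    with ω h1 h2 h3 h4 hω
  rw [h4, Pi.add_apply, h2, h3] at h1
  simpa [hω] using h1

theorem coeFn_smul_one (c : ℝ) : (c • (1 : Ω →ₘ[P] ℝ) : Ω →ₘ[P] ℝ) =ᵐ[P] fun _ => c := by
  filter_upwards [AEEqFun.coeFn_smul c (1 : Ω →ₘ[P] ℝ),
    AEEqFun.coeFn_one (α := Ω) (β := ℝ) (μ := P)] with ω h1 h2
  rw [h1, Pi.smul_apply, h2, Pi.one_apply, smul_eq_mul, mul_one]

theorem coeFn_toExt (X : Ω →ₘ[P] ℝ) : toExt X =ᵐ[P] fun ω => (X ω : EReal) :=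
  AEEqFun.coeFn_comp _ _ _

theorem coeFn_extSub (X : Ω →ₘ[P] ℝ) (Z : Ω →ₘ[P] EReal) :
    extSub X Z =ᵐ[P] fun ω => (X ω : EReal) - Z ω :=
  AEEqFun.coeFn_comp₂ _ _ _ _

/-- On the `G`-event `{Λ ≤ q}` one has `Z ≤ X + q`, and constants lie in `L_G`, so locality gives
`π(Z) ≤ π(X) + q` there. Letting rational `q` decrease to `Λ` pointwise gives the bound. -/
theorem map_le_add_of_eq_add (hL : Admissible hm LF LG) (hGF : LG ≤ LF)
    (hone : (1 : Ω →ₘ[P] ℝ) ∈ LG) (hmon : Monotone π) (hreg : IsRegularMap hm π)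
    (hcas : IsCashAdditive π) {X Z : LF} {Λ : Ω → ℝ} (hΛ : AEStronglyMeasurable[mG] Λ P)
    (hZ : ∀ᵐ ω ∂P, (Z : Ω →ₘ[P] ℝ) ω = (X : Ω →ₘ[P] ℝ) ω + Λ ω) :
    ∀ᵐ ω ∂P, (π Z : Ω →ₘ[P] ℝ) ω ≤ (π X : Ω →ₘ[P] ℝ) ω + Λ ω := by
  obtain ⟨Λ', hΛ', hΛΛ'⟩ := hΛ
  have key : ∀ q : ℚ, ∀ᵐ ω ∂P, Λ' ω ≤ q → (π Z : Ω →ₘ[P] ℝ) ω ≤ (π X : Ω →ₘ[P] ℝ) ω + q := by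
    intro q
    let C : LG := ⟨(q : ℝ) • 1, LG.smul_mem _ hone⟩
    let W : LF := ⟨X + (q : ℝ) • 1, LF.add_mem X.2 (hGF C.2)⟩
    have hW := hcas X W C rfl
    have hA : MeasurableSet[mG] {ω | Λ' ω ≤ q} := hΛ'.measurable measurableSet_Iic
    have := map_le_of_le_on hL hmon hreg (X := Z) (Y := W) hA (by
      filter_upwards [hZ, hΛΛ', coeFn_smul_one (P := P) (q : ℝ),
        AEEqFun.coeFn_add (X : Ω →ₘ[P] ℝ) ((q : ℝ) • 1)] with ω h1 h2 h3 h4 h5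
      rw [h4, Pi.add_apply, h3, h1, h2]
      simpa using h5)
    rw [hW] at this
    filter_upwards [this, coeFn_smul_one (P := P) (q : ℝ),
        AEEqFun.coeFn_add (π X : Ω →ₘ[P] ℝ) C] with ω h1 h2 h3 h4
    have h5 := h1 h4
    rwa [h3, Pi.add_apply, h2] at h5
  filter_upwards [ae_all_iff.2 key, hΛΛ'] with ω h1 h2
  rw [h2]
  refine le_of_forall_gt fun r hr => ?_
  obtain ⟨q, hq1, hq2⟩ := exists_rat_btwn (lt_sub_iff_add_lt'.2 hr)
  have := h1 q hq1.le
  linarith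

/-- Cash additivity extends to all `G`-measurable translations inside `L_F`. -/
theorem map_eq_add_of_eq_add (hL : Admissible hm LF LG) (hGF : LG ≤ LF)
    (hone : (1 : Ω →ₘ[P] ℝ) ∈ LG) (hmon : Monotone π) (hreg : IsRegularMap hm π)
    (hcas : IsCashAdditive π) {X Z : LF} {Λ : Ω → ℝ} (hΛ : AEStronglyMeasurable[mG] Λ P)
    (hZ : ∀ᵐ ω ∂P, (Z : Ω →ₘ[P] ℝ) ω = (X : Ω →ₘ[P] ℝ) ω + Λ ω) :
    ∀ᵐ ω ∂P, (π Z : Ω →ₘ[P] ℝ) ω = (π X : Ω →ₘ[P] ℝ) ω + Λ ω := by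
  have h1 := map_le_add_of_eq_add hL hGF hone hmon hreg hcas hΛ hZ
  have h2 := map_le_add_of_eq_add hL hGF hone hmon hreg hcas (X := Z) (Z := X) hΛ.neg (by
    filter_upwards [hZ] with ω h
    rw [h, Pi.neg_apply]
    ring)
  filter_upwards [h1, h2] with ω h1 h2
  rw [Pi.neg_apply] at h2
  linarith

variable [IsProbabilityMeasure P]

theorem toExt_le_conjugate (hm : mG ≤ mF) (π : LF → LG) (Q : Measure Ω) (ξ : LF) :
    ∀ᵐ ω ∂P, ((condE hm Q (ξ : Ω →ₘ[P] ℝ) ω - (π ξ : Ω →ₘ[P] ℝ) ω : ℝ) : EReal) ≤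
      conjugate hm π Q ω := by
  have h := (isLUB_aeSup {Z | ∃ ξ : LF,
    Z = toExt (condE hm Q (ξ : Ω →ₘ[P] ℝ) - (π ξ : Ω →ₘ[P] ℝ))}).1 ⟨ξ, rfl⟩
  filter_upwards [AEEqFun.coeFn_le.2 h, coeFn_toExt (condE hm Q (ξ : Ω →ₘ[P] ℝ) - (π ξ : Ω →ₘ[P] ℝ)),
    AEEqFun.coeFn_sub (condE hm Q (ξ : Ω →ₘ[P] ℝ)) (π ξ : Ω →ₘ[P] ℝ)] with ω h1 h2 h3
  rw [h2, h3] at h1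
  exact h1

theorem conjugate_le (hm : mG ≤ mF) (π : LF → LG) (Q : Measure Ω) (W : Ω →ₘ[P] EReal)
    (h : ∀ ξ : LF, ∀ᵐ ω ∂P,
      ((condE hm Q (ξ : Ω →ₘ[P] ℝ) ω - (π ξ : Ω →ₘ[P] ℝ) ω : ℝ) : EReal) ≤ W ω) :
    conjugate hm π Q ≤ W := by
  refine (isLUB_aeSup _).2 ?_
  rintro _ ⟨ξ, rfl⟩
  rw [← AEEqFun.coeFn_le]
  filter_upwards [h ξ, coeFn_toExt (condE hm Q (ξ : Ω →ₘ[P] ℝ) - (π ξ : Ω →ₘ[P] ℝ)),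
    AEEqFun.coeFn_sub (condE hm Q (ξ : Ω →ₘ[P] ℝ)) (π ξ : Ω →ₘ[P] ℝ)] with ω h1 h2 h3
  rw [h2, h3]
  exact h1

/-- `K(X, Q) = E_Q[X | G] - π*(Q)` for cash additive maps. -/
theorem K_eq_extSub (hL : Admissible hm LF LG) (hGF : LG ≤ LF)
    (hone : (1 : Ω →ₘ[P] ℝ) ∈ LG) (hmon : Monotone π) (hreg : IsRegularMap hm π)
    (hcas : IsCashAdditive π) {Q : Measure Ω} (hQ : Q ∈ dualProb LF ∩ probAgreeing mG P)
    (hE : ∀ ξ ∈ LF, condE hm Q ξ ∈ LF) (X : LF) :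
    K mG π X Q = extSub (condE hm Q (X : Ω →ₘ[P] ℝ)) (conjugate hm π Q) := by
  have hint : ∀ ξ ∈ LF, Integrable (fun ω => density P Q ω * ξ ω) P := fun ξ hξ =>
    integrable_mul_of_mem_orderDual hQ.1.2.2 hξ
  have hdi : Integrable (density P Q) P := (mem_orderDual_iff.1 hQ.1.2.2).1
  have hmeas : ∀ ξ : Ω →ₘ[P] ℝ, AEStronglyMeasurable[mG] (condE hm Q ξ) P := fun ξ =>
    ⟨condExp mG Q ξ, stronglyMeasurable_condExp, coeFn_condE hm Q ξ⟩
  have hK := isGLB_aeInf {Z | ∃ ξ : LF, condExp mG Q (X : Ω →ₘ[P] ℝ) ≤ᵐ[Q]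
    condExp mG Q (ξ : Ω →ₘ[P] ℝ) ∧ Z = toExt (π ξ : Ω →ₘ[P] ℝ)}
  refine le_antisymm ?_ (hK.2 ?_)
  -- Since `E_Q[X|G]` is finite, the bound on `K(X,Q)` is equivalent to this upper bound on the
  -- conjugate, which is checked one `ξ` at a time.
  · have hle : conjugate hm π Q ≤ extSub (condE hm Q (X : Ω →ₘ[P] ℝ)) (K mG π X Q) := by
      refine conjugate_le hm π Q _ fun ξ => ?_
      let D : Ω →ₘ[P] ℝ := condE hm Q X + -condE hm Q ξ
      have hD : D ∈ LF := LF.add_mem (hE _ X.2) (LF.neg_mem (hE _ ξ.2))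
      have hDc : D =ᵐ[P] fun ω => condE hm Q (X : Ω →ₘ[P] ℝ) ω -
          condE hm Q (ξ : Ω →ₘ[P] ℝ) ω := by
        filter_upwards [AEEqFun.coeFn_add (condE hm Q (X : Ω →ₘ[P] ℝ)) (-condE hm Q ξ),
          AEEqFun.coeFn_neg (condE hm Q (ξ : Ω →ₘ[P] ℝ))] with ω h1 h2
        rw [h1, Pi.add_apply, h2, Pi.neg_apply, sub_eq_add_neg]
      have hDm : AEStronglyMeasurable[mG] D P :=
        ((hmeas X).sub (hmeas ξ)).congr hDc.symm
      let ζ : LF := ⟨ξ + D, LF.add_mem ξ.2 hD⟩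
      have hπ := map_eq_add_of_eq_add hL hGF hone hmon hreg hcas (X := ξ) (Z := ζ) hDm
        (AEEqFun.coeFn_add _ _)
      have hcond : condExp mG Q (X : Ω →ₘ[P] ℝ) =ᵐ[P] condExp mG Q (ζ : Ω →ₘ[P] ℝ) := by
        filter_upwards [condE_add hm hQ.2 (hint _ ξ.2) (hint _ hD),
          condE_of_measurable hm hQ.2 hdi hDm (hint _ hD), hDc,
          coeFn_condE hm Q (X : Ω →ₘ[P] ℝ), coeFn_condE hm Q (ζ : Ω →ₘ[P] ℝ)] with ω h1 h2 h3 h4 h5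
        rw [← h4, ← h5]
        change _ = condE hm Q ((ξ : Ω →ₘ[P] ℝ) + D) ω
        rw [h1, h2, h3]
        ring
      have hKle : K mG π X Q ≤ toExt (π ζ : Ω →ₘ[P] ℝ) :=
        hK.1 ⟨ζ, (hQ.1.2.1.ae_le hcond.le), rfl⟩
      filter_upwards [AEEqFun.coeFn_le.2 hKle, coeFn_toExt (π ζ : Ω →ₘ[P] ℝ), hπ, hDc,
        coeFn_extSub (condE hm Q (X : Ω →ₘ[P] ℝ)) (K mG π X Q)] with ω h1 h2 h3 h4 h5
      rw [h2, h3, h4] at h1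
      rw [h5]
      refine le_trans (le_of_eq ?_) (EReal.sub_le_sub le_rfl h1)
      norm_cast
      ring
    rw [← AEEqFun.coeFn_le]
    filter_upwards [AEEqFun.coeFn_le.2 hle,
      coeFn_extSub (condE hm Q (X : Ω →ₘ[P] ℝ)) (K mG π X Q),
      coeFn_extSub (condE hm Q (X : Ω →ₘ[P] ℝ)) (conjugate hm π Q)] with ω h1 h2 h3
    rw [h3]
    rw [h2] at h1
    have := EReal.sub_le_sub (le_refl (condE hm Q (X : Ω →ₘ[P] ℝ) ω : EReal)) h1
    rwa [coe_sub_coe_sub] at this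
  · rintro _ ⟨ξ, hξ, rfl⟩
    have hξP := ae_le_of_ae_le_agreeing hm hQ.2 stronglyMeasurable_condExp
      stronglyMeasurable_condExp hξ
    rw [← AEEqFun.coeFn_le]
    filter_upwards [hξP, toExt_le_conjugate hm π Q ξ, coeFn_toExt (π ξ : Ω →ₘ[P] ℝ),
      coeFn_extSub (condE hm Q (X : Ω →ₘ[P] ℝ)) (conjugate hm π Q),
      coeFn_condE hm Q (X : Ω →ₘ[P] ℝ), coeFn_condE hm Q (ξ : Ω →ₘ[P] ℝ)]
      with ω h1 h2 h3 h4 h5 h6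
    rw [h3, h4]
    refine (EReal.sub_le_sub le_rfl h2).trans ?_
    rw [← h5, ← h6] at h1
    norm_cast
    linarith

end Maps

/-! ### Exhaustion and locality of conditional expectations -/

section Auxiliary

variable {Ω : Type u} {mG mF : MeasurableSpace Ω} {P : Measure Ω}

/-- A family of measurable sets stable under finite unions is exhausted by a sequence. -/
theorem exists_monotone_exhausting [IsFiniteMeasure P] {S : Set (Set Ω)}
    (hmeas : ∀ A ∈ S, MeasurableSet A) (hne : S.Nonempty)
    (hunion : ∀ A ∈ S, ∀ B ∈ S, A ∪ B ∈ S) :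
    ∃ A : ℕ → Set Ω, Monotone A ∧ (∀ n, A n ∈ S) ∧ ∀ B ∈ S, P (B \ ⋃ n, A n) = 0 := by
  obtain ⟨c, -, hc, hcS⟩ := exists_seq_tendsto_sSup (hne.image P) (OrderTop.bddAbove _)
  choose t ht hct using hcS
  have hacc : ∀ n, Set.accumulate t n ∈ S := fun n => by
    induction n with
    | zero => simpa using ht 0
    | succ n ih =>
      rw [Set.accumulate_succ]
      exact hunion _ ih _ (ht _)
  refine ⟨Set.accumulate t, Set.monotone_accumulate, hacc, fun B hB => ?_⟩
  set U := ⋃ n, Set.accumulate t n with hU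
  have hUm : MeasurableSet U := MeasurableSet.iUnion fun n => hmeas _ (hacc n)
  have hge : sSup (P '' S) ≤ P U := le_of_tendsto' hc fun n => by
    rw [← hct]
    exact measure_mono (Set.subset_accumulate.trans (Set.subset_iUnion _ n))
  -- `U` already reaches the supremal mass, and `B ∪ U` is an increasing limit of members of `S`, so
  -- `B` adds no mass.
  have hle : P (B ∪ U) ≤ sSup (P '' S) := by
    have hmono : Monotone fun n => B ∪ Set.accumulate t n := fun i j hij =>
      Set.union_subset_union_right B (Set.monotone_accumulate hij)
    have hlim := tendsto_measure_iUnion_atTop (μ := P) hmono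
    rw [← Set.union_iUnion] at hlim
    exact le_of_tendsto' hlim fun n => le_sSup ⟨_, hunion _ hB _ (hacc n), rfl⟩
  have hsum : P (B \ U) + P U = P (B ∪ U) := by
    rw [← measure_union Set.disjoint_sdiff_left hUm, Set.sdiff_union_self]
  have : P (B \ U) + P U ≤ 0 + P U := by
    rw [hsum, zero_add]
    exact hle.trans hge
  exact nonpos_iff_eq_zero.1 ((ENNReal.add_le_add_iff_right (measure_ne_top P U)).1 this)

/-- The indicator of a `G`-event commutes with `E_P[·|G]`. -/
theorem condExp_congr_on [IsFiniteMeasure P] {f g : Ω → ℝ} (hf : Integrable f P)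
    (hg : Integrable g P) {A : Set Ω} (hA : MeasurableSet[mG] A)
    (h : ∀ᵐ ω ∂P, ω ∈ A → f ω = g ω) :
    ∀ᵐ ω ∂P, ω ∈ A → condExp mG P f ω = condExp mG P g ω := by
  have e : A.indicator f =ᵐ[P] A.indicator g := by
    filter_upwards [h] with ω hω
    by_cases hA : ω ∈ A
    · simp [hA, hω hA]
    · simp [hA]
  filter_upwards [condExp_indicator hf hA, condExp_indicator hg hA,
    condExp_congr_ae (m := mG) e] with ω h1 h2 h3 hω
  rw [h3, h2] at h1
  simpa [hω] using h1.symm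

/-- A nonnegative function vanishes where its conditional expectation does. -/
theorem ae_eq_zero_of_condExp_eq_zero [IsFiniteMeasure P] (hm : mG ≤ mF) {g : Ω → ℝ}
    (hg : Integrable g P) (h0 : 0 ≤ᵐ[P] g) :
    ∀ᵐ ω ∂P, condExp mG P g ω = 0 → g ω = 0 := by
  have hA : MeasurableSet[mG] {ω | condExp mG P g ω = 0} :=
    stronglyMeasurable_condExp.measurable (measurableSet_singleton 0)
  have hi : ∫ ω in {ω | condExp mG P g ω = 0}, g ω ∂P = 0 := by
    rw [← setIntegral_condExp hm hg hA]
    exact setIntegral_eq_zero_of_forall_eq_zero fun ω hω => hω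
  rw [setIntegral_eq_zero_iff_of_nonneg_ae (ae_restrict_of_ae h0) hg.integrableOn] at hi
  exact (ae_restrict_iff' (hm _ hA)).1 hi

theorem density_nonneg (Q : Measure Ω) : ∀ᵐ ω ∂P, 0 ≤ density P Q ω := by
  filter_upwards [coeFn_density (P := P) (Q := Q)] with ω h
  rw [h]
  exact ENNReal.toReal_nonneg

end Auxiliary

/-! ### Normalizing densities and localizing a separation -/

section Densities

variable {Ω : Type u} {mG mF : MeasurableSpace Ω} {P : Measure Ω} [IsProbabilityMeasure P]
  {hm : mG ≤ mF} {L : Submodule ℝ (Ω →ₘ[P] ℝ)}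

/-- A nonnegative density yields an agreeing probability. -/
theorem exists_dualProb_of_density (hm : mG ≤ mF) {h : Ω →ₘ[P] ℝ} (hh : h ∈ orderDual L)
    (h0 : ∀ᵐ ω ∂P, 0 ≤ h ω) (h1 : condExp mG P h =ᵐ[P] fun _ => (1 : ℝ)) :
    ∃ Q ∈ dualProb L ∩ probAgreeing mG P, density P Q = h := by
  have hi : Integrable h P := (mem_orderDual_iff.1 hh).1
  let Q := P.withDensity fun ω => ENNReal.ofReal (h ω)
  have hmeas : Measurable fun ω => ENNReal.ofReal (h ω) := h.measurable.ennreal_ofReal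
  have hQP : Q ≪ P := withDensity_absolutelyContinuous _ _
  have hG : ∀ A, MeasurableSet[mG] A → Q A = P A := fun A hA => by
    rw [withDensity_apply _ (hm A hA), ← ofReal_integral_eq_lintegral_ofReal hi.integrableOn
      (ae_restrict_of_ae h0), ← setIntegral_condExp hm hi hA,
      setIntegral_congr_ae (g := fun _ => (1 : ℝ)) (hm A hA) (h1.mono fun ω hω _ => hω)]
    simp
  have hQ : IsProbabilityMeasure Q := ⟨by rw [hG _ MeasurableSet.univ, measure_univ]⟩
  have hd : density P Q = h := by
    refine AEEqFun.ext ?_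
    filter_upwards [coeFn_density (P := P) (Q := Q), Measure.rnDeriv_withDensity P hmeas, h0]
      with ω e1 e2 e3
    rw [e1, e2, ENNReal.toReal_ofReal e3]
  exact ⟨Q, ⟨⟨hQ, hQP, by rwa [hd]⟩, hQ, hQP, hG⟩, hd⟩

/-- Local normalization: on a `G`-event where `E_P[g | G]` is bounded away from zero, `g` is
proportional to the density of an agreeing probability, up to a `G`-measurable factor. -/
theorem exists_normalized (hm : mG ≤ mF) {g : Ω →ₘ[P] ℝ} (hg : g ∈ orderDual L)
    (g_nonneg : ∀ᵐ ω ∂P, 0 ≤ g ω)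
    {Q₀ : Measure Ω} (hQ₀ : Q₀ ∈ dualProb L ∩ probAgreeing mG P) {C : Set Ω}
    (hC : MeasurableSet[mG] C) {δ : ℝ} (hδ : 0 < δ) (hγ : ∀ ω ∈ C, δ ≤ condExp mG P g ω) :
    ∃ Q ∈ dualProb L ∩ probAgreeing mG P, ∀ ξ ∈ L, ∀ᵐ ω ∂P, ω ∈ C →
      condExp mG P (fun ω => g ω * ξ ω) ω = condExp mG P g ω * condE hm Q ξ ω := by
  set γ := condExp mG P g with hγdef
  have hγm : StronglyMeasurable[mG] γ := stronglyMeasurable_condExp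
  -- The new density is `g / γ` on `C` and `dQ₀/dP` off `C`: both pieces have conditional
  -- expectation `1`.
  let a : Ω → ℝ := C.indicator fun ω => (γ ω)⁻¹
  let b : Ω → ℝ := Cᶜ.indicator fun _ => 1
  have ham : StronglyMeasurable[mG] a := (hγm.measurable.inv.stronglyMeasurable).indicator hC
  have hbm : StronglyMeasurable[mG] b := stronglyMeasurable_const.indicator hC.compl
  have ha0 : ∀ ω, 0 ≤ a ω := fun ω => Set.indicator_nonneg
    (fun ω hω => inv_nonneg.2 (hδ.le.trans (hγ ω hω))) ω
  have hab : ∀ ω, a ω ≤ δ⁻¹ := fun ω => by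
    by_cases h : ω ∈ C
    · simpa [a, h] using inv_anti₀ hδ (hγ ω h)
    · simpa [a, h] using hδ.le
  have hb0 : ∀ ω, 0 ≤ b ω := fun ω => Set.indicator_nonneg (fun _ _ => zero_le_one) ω
  have hb1 : ∀ ω, b ω ≤ 1 := fun ω => Set.indicator_le' (fun _ _ => le_rfl)
    (fun _ _ => zero_le_one) ω
  let g₀ := density P Q₀
  have hg₀ : g₀ ∈ orderDual L := hQ₀.1.2.2
  let h : Ω →ₘ[P] ℝ := AEEqFun.mk (fun ω => a ω * g ω + b ω * g₀ ω)
    (((ham.mono hm).aestronglyMeasurable.mul g.aestronglyMeasurable).add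
      ((hbm.mono hm).aestronglyMeasurable.mul g₀.aestronglyMeasurable))
  have hcoe : h =ᵐ[P] fun ω => a ω * g ω + b ω * g₀ ω := AEEqFun.coeFn_mk _ _
  have h0 : ∀ᵐ ω ∂P, 0 ≤ h ω := by
    filter_upwards [hcoe, g_nonneg, density_nonneg Q₀] with ω e1 e2 e3
    rw [e1]
    exact add_nonneg (mul_nonneg (ha0 ω) e2) (mul_nonneg (hb0 ω) e3)
  -- By solidity, since `h ≤ δ⁻¹ g + g₀`; this is where `γ ≥ δ` on `C` is needed.
  have hh : h ∈ orderDual L := by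
    refine mem_orderDual_of_abs_le (add_mem_orderDual (smul_mem_orderDual δ⁻¹ hg) hg₀) ?_
    filter_upwards [hcoe, g_nonneg, density_nonneg Q₀, h0, AEEqFun.coeFn_add (δ⁻¹ • g) g₀,
      AEEqFun.coeFn_smul δ⁻¹ g] with ω e1 e2 e3 e4 e5 e6
    rw [abs_of_nonneg e4, e1, e5, Pi.add_apply, e6, Pi.smul_apply, smul_eq_mul]
    exact add_le_add (mul_le_mul_of_nonneg_right (hab ω) e2)
      (mul_le_of_le_one_left e3 (hb1 ω))
  have hcond : ∀ f : Ω → ℝ, Integrable (fun ω => g ω * f ω) P →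
      Integrable (fun ω => g₀ ω * f ω) P →
      condExp mG P (fun ω => h ω * f ω) =ᵐ[P] fun ω =>
        a ω * condExp mG P (fun ω => g ω * f ω) ω +
          b ω * condExp mG P (fun ω => g₀ ω * f ω) ω := by
    intro f h1 h2
    have i1 : Integrable (a * fun ω => g ω * f ω) P :=
      h1.bdd_mul (ham.mono hm).aestronglyMeasurable (c := δ⁻¹) (ae_of_all _ fun ω => by
        rw [Real.norm_of_nonneg (ha0 ω)]
        exact hab ω)
    have i2 : Integrable (b * fun ω => g₀ ω * f ω) P :=
      h2.bdd_mul (hbm.mono hm).aestronglyMeasurable (c := 1) (ae_of_all _ fun ω => by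
        rw [Real.norm_of_nonneg (hb0 ω)]
        exact hb1 ω)
    have e : (fun ω => h ω * f ω) =ᵐ[P]
        (a * fun ω => g ω * f ω) + b * fun ω => g₀ ω * f ω := by
      filter_upwards [hcoe] with ω hω
      simp only [hω, Pi.add_apply, Pi.mul_apply]
      ring
    filter_upwards [condExp_congr_ae (m := mG) e, condExp_add i1 i2 mG,
      condExp_mul_of_stronglyMeasurable_left ham i1 h1,
      condExp_mul_of_stronglyMeasurable_left hbm i2 h2] with ω e1 e2 e3 e4
    rw [e1, e2, Pi.add_apply, e3, e4, Pi.mul_apply, Pi.mul_apply]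
  have hgi : Integrable g P := (mem_orderDual_iff.1 hg).1
  have hg₀i : Integrable g₀ P := (mem_orderDual_iff.1 hg₀).1
  have hone : condExp mG P h =ᵐ[P] fun _ => (1 : ℝ) := by
    have := hcond (fun _ => 1) (by simpa using hgi) (by simpa using hg₀i)
    simp only [mul_one] at this
    filter_upwards [this, condExp_density hm hQ₀.2 hg₀i] with ω e1 e2
    rw [e1]
    change a ω * γ ω + b ω * condExp mG P g₀ ω = 1
    rw [e2]
    by_cases hω : ω ∈ C
    · have : γ ω ≠ 0 := (hδ.trans_le (hγ ω hω)).ne'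
      simp [a, b, hω, this]
    · simp [a, b, hω]
  obtain ⟨Q, hQ, hd⟩ := exists_dualProb_of_density hm hh h0 hone
  refine ⟨Q, hQ, fun ξ hξ => ?_⟩
  have hi := integrable_mul_of_mem_orderDual hQ.1.2.2 hξ
  filter_upwards [condE_ae_eq hm hQ.2 hi, hcond ξ (integrable_mul_of_mem_orderDual hg hξ)
    (integrable_mul_of_mem_orderDual hg₀ hξ)] with ω e1 e2 hω
  rw [e1, hd, e2]
  have : γ ω ≠ 0 := (hδ.trans_le (hγ ω hω)).ne'
  simp [a, b, hω, this]

/-- Localization of a strict separation from a set stable under `G`-pasting. -/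
theorem exists_separating_event (hm : mG ≤ mF) {g : Ω →ₘ[P] ℝ} (hg : g ∈ orderDual L)
    {S : Set L} (hpaste : ∀ ξ ∈ S, ∀ η ∈ S, ∀ A, MeasurableSet[mG] A → ∃ ζ ∈ S, ∀ᵐ ω ∂P,
      (ω ∈ A → (ζ : Ω →ₘ[P] ℝ) ω = (ξ : Ω →ₘ[P] ℝ) ω) ∧
      (ω ∉ A → (ζ : Ω →ₘ[P] ℝ) ω = (η : Ω →ₘ[P] ℝ) ω))
    (hne : S.Nonempty) {x : L} {s : ℝ}
    (hS : ∀ ξ ∈ S, ∫ ω, g ω * (ξ : Ω →ₘ[P] ℝ) ω ∂P < s)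
    (hx : s < ∫ ω, g ω * (x : Ω →ₘ[P] ℝ) ω ∂P) :
    ∃ C, MeasurableSet[mG] C ∧ P C ≠ 0 ∧ ∀ ξ ∈ S, ∀ᵐ ω ∂P, ω ∈ C →
      condExp mG P (fun ω => g ω * (ξ : Ω →ₘ[P] ℝ) ω) ω <
        condExp mG P (fun ω => g ω * (x : Ω →ₘ[P] ℝ) ω) ω := by
  obtain ⟨η, hη⟩ := hne
  let f : L → Ω → ℝ := fun ξ => condExp mG P fun ω => g ω * (ξ : Ω →ₘ[P] ℝ) ω
  have hgi : ∀ ξ : L, Integrable (fun ω => g ω * (ξ : Ω →ₘ[P] ℝ) ω) P := fun ξ =>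
    integrable_mul_of_mem_orderDual hg ξ.2
  have hfm : ∀ ξ, StronglyMeasurable[mG] (f ξ) := fun ξ => stronglyMeasurable_condExp
  have hfi : ∀ ξ, Integrable (f ξ) P := fun ξ => integrable_condExp
  have hint : ∀ ξ, ∫ ω, f ξ ω ∂P = ∫ ω, g ω * (ξ : Ω →ₘ[P] ℝ) ω ∂P := fun ξ =>
    integral_condExp hm
  have hfpaste : ∀ ξ ∈ S, ∀ η ∈ S, ∀ A, MeasurableSet[mG] A → ∃ ζ ∈ S, ∀ᵐ ω ∂P,
      (ω ∈ A → f ζ ω = f ξ ω) ∧ (ω ∉ A → f ζ ω = f η ω) := by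
    intro ξ hξ η hη A hA
    obtain ⟨ζ, hζ, h⟩ := hpaste ξ hξ η hη A hA
    refine ⟨ζ, hζ, ?_⟩
    have h1 := condExp_congr_on (hgi ζ) (hgi ξ) hA
      (h.mono fun ω hω hωA => by rw [hω.1 hωA])
    have h2 := condExp_congr_on (hgi ζ) (hgi η) hA.compl
      (h.mono fun ω hω hωA => by rw [hω.2 hωA])
    filter_upwards [h1, h2] with ω h1 h2 using ⟨h1, h2⟩
  obtain ⟨δ, hδ, hδs⟩ : ∃ δ > 0, s < (∫ ω, f x ω ∂P) - δ := by
    rw [hint]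
    exact ⟨((∫ ω, g ω * (x : Ω →ₘ[P] ℝ) ω ∂P) - s) / 2, by linarith, by linarith⟩
  -- The events on which a single element of `S` comes within `δ` of `x` conditionally. Pasting
  -- gives stability under unions, and the complement of a maximal such event is the required `C`.
  let 𝒜 : Set (Set Ω) := {A | MeasurableSet[mG] A ∧
    ∃ ξ ∈ S, ∀ᵐ ω ∂P, ω ∈ A → f x ω - δ ≤ f ξ ω}
  obtain ⟨A, hmono, hA𝒜, hmax⟩ := exists_monotone_exhausting (P := P) (S := 𝒜)
    (fun A hA => hm A hA.1) ⟨∅, @MeasurableSet.empty _ mG, η, hη, by simp⟩ (by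
      rintro A ⟨hA, ξ, hξ, hAξ⟩ B ⟨hB, ξ', hξ', hBξ⟩
      obtain ⟨ζ, hζ, h⟩ := hfpaste ξ hξ ξ' hξ' A hA
      refine ⟨hA.union hB, ζ, hζ, ?_⟩
      filter_upwards [hAξ, hBξ, h] with ω h1 h2 h3 hω
      by_cases hωA : ω ∈ A
      · rw [h3.1 hωA]
        exact h1 hωA
      · rw [h3.2 hωA]
        exact h2 (hω.resolve_left hωA))
  have hUm : MeasurableSet[mG] (⋃ n, A n) := MeasurableSet.iUnion fun n => (hA𝒜 n).1
  refine ⟨(⋃ n, A n)ᶜ, hUm.compl, fun hnull => ?_, fun ξ hξ => ?_⟩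
  · have hφi : Integrable (fun ω => f x ω - δ - f η ω) P :=
      ((hfi x).sub (integrable_const δ)).sub (hfi η)
    have hlim := tendsto_setIntegral_of_monotone (μ := P) (fun n => hm _ (hA𝒜 n).1) hmono
      hφi.integrableOn
    -- Replacing `η` by `ξ` on `A n` stays in `S`, hence below `s`. If the `A n` exhausted `Ω`, the
    -- limit would give `∫ f x - δ ≤ s`, against the choice of `δ`.
    have hle : ∀ n, ∫ ω in A n, (f x ω - δ - f η ω) ∂P ≤ s - ∫ ω, f η ω ∂P := by
      intro n
      obtain ⟨hAn, ξ, hξ, hAξ⟩ := hA𝒜 n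
      obtain ⟨ζ, hζ, h⟩ := hfpaste ξ hξ η hη _ hAn
      have h1 : ∫ ω in A n, (f x ω - δ - f η ω) ∂P ≤ ∫ ω, (f ζ ω - f η ω) ∂P := by
        rw [← integral_indicator (hm _ hAn)]
        refine integral_mono_ae (hφi.indicator (hm _ hAn)) ((hfi ζ).sub (hfi η)) ?_
        filter_upwards [hAξ, h] with ω h1 h2
        by_cases hω : ω ∈ A n
        · simp only [hω, Set.indicator_of_mem, h2.1 hω]
          linarith [h1 hω]
        · simp [hω, h2.2 hω]
      rw [integral_sub (hfi ζ) (hfi η), hint ζ] at h1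
      linarith [hS ζ hζ]
    have h2 := le_of_tendsto' hlim hle
    have hU : (⋃ n, A n) =ᵐ[P] Set.univ := ae_eq_univ.2 hnull
    have h3 : ∫ ω, (f x ω - δ - f η ω) ∂P = (∫ ω, f x ω ∂P) - δ - ∫ ω, f η ω ∂P := by
      rw [integral_sub (f := fun ω => f x ω - δ) ((hfi x).sub (integrable_const δ)) (hfi η),
        integral_sub (hfi x) (integrable_const δ)]
      simp
    rw [setIntegral_congr_set hU, setIntegral_univ, h3] at h2
    linarith
  -- By maximality this event is almost surely contained in `⋃ n, A n`.
  · have hB : {ω | f x ω - δ ≤ f ξ ω} ∈ 𝒜 :=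
      ⟨((hfm x).sub stronglyMeasurable_const).measurableSet_le (hfm ξ), ξ, hξ,
        ae_of_all _ fun ω hω => hω⟩
    have := hmax _ hB
    rw [measure_eq_zero_iff_ae_notMem] at this
    filter_upwards [this] with ω hω hωU
    have h3 : ¬ (f x ω - δ ≤ f ξ ω) := fun h => hω ⟨h, hωU⟩
    change f ξ ω < f x ω
    linarith

end Densities

/-! ### Acceptance set and dual representation -/

section Duality

variable {Ω : Type u} {mG mF : MeasurableSpace Ω} {P : Measure Ω}
  {hm : mG ≤ mF} {LF LG : Submodule ℝ (Ω →ₘ[P] ℝ)} {π : LF → LG}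

theorem coeFn_paste (X Y : Ω →ₘ[P] ℝ) {A : Set Ω} (hA : MeasurableSet A) :
    ∀ᵐ ω ∂P, (ω ∈ A → (X * ind P hA + Y * ind P hA.compl : Ω →ₘ[P] ℝ) ω = X ω) ∧
      (ω ∉ A → (X * ind P hA + Y * ind P hA.compl : Ω →ₘ[P] ℝ) ω = Y ω) := by
  filter_upwards [coeFn_mul_ind X hA, coeFn_mul_ind Y hA.compl,
    AEEqFun.coeFn_add (X * ind P hA) (Y * ind P hA.compl)] with ω h1 h2 h3
  rw [h3, Pi.add_apply, h1, h2]
  constructor <;> intro h <;> simp [h]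

theorem exists_paste (hL : Admissible hm LF LG) (hreg : IsRegularMap hm π) (X Y : LF) {A : Set Ω}
    (hA : MeasurableSet[mG] A) : ∃ Z : LF, ∀ᵐ ω ∂P,
      (ω ∈ A → (Z : Ω →ₘ[P] ℝ) ω = (X : Ω →ₘ[P] ℝ) ω ∧
        (π Z : Ω →ₘ[P] ℝ) ω = (π X : Ω →ₘ[P] ℝ) ω) ∧
      (ω ∉ A → (Z : Ω →ₘ[P] ℝ) ω = (Y : Ω →ₘ[P] ℝ) ω ∧
        (π Z : Ω →ₘ[P] ℝ) ω = (π Y : Ω →ₘ[P] ℝ) ω) := by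
  refine ⟨⟨X * ind P (hm A hA) + Y * ind P (hm A hA).compl,
    LF.add_mem (hL.ind_memF _ X.2 _ _) (hL.ind_memF _ Y.2 _ _)⟩, ?_⟩
  rw [hreg X Y _ A hA rfl]
  filter_upwards [coeFn_paste (X : Ω →ₘ[P] ℝ) Y (hm A hA),
    coeFn_paste (π X : Ω →ₘ[P] ℝ) (π Y) (hm A hA)] with ω h1 h2
  exact ⟨fun h => ⟨h1.1 h, h2.1 h⟩, fun h => ⟨h1.2 h, h2.2 h⟩⟩

/-- Translation of `X` by `-π(X) + c`. -/
theorem exists_translate (hGF : LG ≤ LF) (hone : (1 : Ω →ₘ[P] ℝ) ∈ LG) (hcas : IsCashAdditive π)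
    (X : LF) (c : ℝ) : ∃ Z : LF, ∀ᵐ ω ∂P,
      (Z : Ω →ₘ[P] ℝ) ω = (X : Ω →ₘ[P] ℝ) ω + (c - (π X : Ω →ₘ[P] ℝ) ω) ∧
        (π Z : Ω →ₘ[P] ℝ) ω = c := by
  let Λ : LG := ⟨c • 1 - π X, LG.sub_mem (LG.smul_mem _ hone) (π X).2⟩
  let Z : LF := ⟨X + Λ, LF.add_mem X.2 (hGF Λ.2)⟩
  refine ⟨Z, ?_⟩
  rw [hcas X Z Λ rfl, show (Z : Ω →ₘ[P] ℝ) = X + Λ from rfl]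
  filter_upwards [AEEqFun.coeFn_add (X : Ω →ₘ[P] ℝ) Λ, AEEqFun.coeFn_add (π X : Ω →ₘ[P] ℝ) Λ,
    AEEqFun.coeFn_sub (c • (1 : Ω →ₘ[P] ℝ)) (π X), coeFn_smul_one (P := P) c] with ω h1 h2 h3 h4
  have h5 : (Λ : Ω →ₘ[P] ℝ) ω = c - (π X : Ω →ₘ[P] ℝ) ω := by
    rw [h3, Pi.sub_apply, h4]
  rw [h1, h2, Pi.add_apply, Pi.add_apply, h5]
  exact ⟨rfl, by ring⟩

/-- A real weight `a` is the constant `G`-measurable weight `Λ = a`. -/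
theorem convex_acceptance (hqc : IsQuasiconvex mG π) : Convex ℝ {X : LF | π X ≤ 0} := by
  intro X hX Y hY a b ha hb hab
  have hX' : (π X : Ω →ₘ[P] ℝ) ≤ 0 := hX
  have hY' : (π Y : Ω →ₘ[P] ℝ) ≤ 0 := hY
  have hc := coeFn_smul_one (P := P) a
  refine le_trans (hqc X Y (a • X + b • Y) (a • 1) ?_ ?_ ?_ ?_) (sup_le hX' hY')
  · exact ⟨fun _ => a, stronglyMeasurable_const, hc⟩
  · rw [← AEEqFun.coeFn_le]
    filter_upwards [hc, AEEqFun.coeFn_zero (α := Ω) (β := ℝ) (μ := P)] with ω h1 h2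
    rw [h1, h2]
    exact ha
  · rw [← AEEqFun.coeFn_le]
    filter_upwards [hc, AEEqFun.coeFn_one (α := Ω) (β := ℝ) (μ := P)] with ω h1 h2
    rw [h1, h2, Pi.one_apply]
    linarith
  · have : (1 : Ω →ₘ[P] ℝ) - a • 1 = b • 1 := by
      rw [sub_eq_iff_eq_add', ← add_smul, hab, one_smul]
    rw [this, Submodule.coe_add, Submodule.coe_smul, Submodule.coe_smul]
    refine AEEqFun.ext ?_
    filter_upwards [hc, coeFn_smul_one (P := P) b,
      AEEqFun.coeFn_add (a • (X : Ω →ₘ[P] ℝ)) (b • (Y : Ω →ₘ[P] ℝ)), AEEqFun.coeFn_smul a (X : Ω →ₘ[P] ℝ),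
      AEEqFun.coeFn_smul b (Y : Ω →ₘ[P] ℝ), AEEqFun.coeFn_add ((a • 1) * (X : Ω →ₘ[P] ℝ))
        ((b • 1) * (Y : Ω →ₘ[P] ℝ)), AEEqFun.coeFn_mul (a • (1 : Ω →ₘ[P] ℝ)) (X : Ω →ₘ[P] ℝ),
      AEEqFun.coeFn_mul (b • (1 : Ω →ₘ[P] ℝ)) (Y : Ω →ₘ[P] ℝ)] with ω h1 h2 h3 h4 h5 h6 h7 h8
    rw [h3, h6, Pi.add_apply, Pi.add_apply, h4, h5, h7, h8, Pi.mul_apply, Pi.mul_apply, h1, h2]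
    rfl

/-- A functional bounded above on a nonempty downward closed set is positive. -/
theorem nonneg_of_bounded_above {g : Ω →ₘ[P] ℝ} (hg : g ∈ orderDual LF) {S : Set LF}
    (hdown : ∀ ξ ∈ S, ∀ ζ : LF, ζ ≤ ξ → ζ ∈ S) (hne : S.Nonempty) {s : ℝ}
    (hind : ∀ (A : Set Ω) (hA : MeasurableSet A), ind P hA ∈ LF)
    (hS : ∀ ξ ∈ S, ∫ ω, g ω * (ξ : Ω →ₘ[P] ℝ) ω ∂P < s) : ∀ᵐ ω ∂P, 0 ≤ g ω := by
  obtain ⟨η, hη⟩ := hne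
  have hN : MeasurableSet {ω | g ω < 0} := g.measurable measurableSet_Iio
  let J : LF := ⟨ind P hN, hind _ hN⟩
  have hJ : (J : Ω →ₘ[P] ℝ) =ᵐ[P] {ω | g ω < 0}.indicator fun _ => (1 : ℝ) := coeFn_ind hN
  have hgJ := integrable_mul_of_mem_orderDual hg J.2
  have hgη := integrable_mul_of_mem_orderDual hg η.2
  have hnp : ∀ᵐ ω ∂P, 0 ≤ -(g ω * (J : Ω →ₘ[P] ℝ) ω) := by
    filter_upwards [hJ] with ω h
    rw [h]
    by_cases hω : g ω < 0
    · simpa [hω] using hω.le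
    · simp [hω]
  set a := ∫ ω, -(g ω * (J : Ω →ₘ[P] ℝ) ω) ∂P with ha
  have ha0 : 0 ≤ a := integral_nonneg_of_ae hnp
  -- Subtracting `t` times the indicator of `{g < 0}` from `η` stays in `S` and raises the pairing
  -- by `t * a`, so boundedness forces `a = 0`.
  have hlt : ∀ t : ℝ, 0 ≤ t → ∫ ω, g ω * (η : Ω →ₘ[P] ℝ) ω ∂P + t * a < s := by
    intro t ht
    have hcoe : ((η - t • J : LF) : Ω →ₘ[P] ℝ) =ᵐ[P] fun ω =>
        (η : Ω →ₘ[P] ℝ) ω - t * (J : Ω →ₘ[P] ℝ) ω := by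
      filter_upwards [AEEqFun.coeFn_sub (η : Ω →ₘ[P] ℝ) (t • (J : Ω →ₘ[P] ℝ)),
        AEEqFun.coeFn_smul t (J : Ω →ₘ[P] ℝ)] with ω h1 h2
      rw [Submodule.coe_sub, Submodule.coe_smul, h1, Pi.sub_apply, h2, Pi.smul_apply, smul_eq_mul]
    have hle : η - t • J ≤ η := by
      change ((η - t • J : LF) : Ω →ₘ[P] ℝ) ≤ η
      rw [← AEEqFun.coeFn_le]
      filter_upwards [hcoe, hJ] with ω h1 h2
      rw [h1, h2]
      have : 0 ≤ {ω | g ω < 0}.indicator (fun _ => (1 : ℝ)) ω :=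
        Set.indicator_nonneg (fun _ _ => zero_le_one) ω
      nlinarith
    have := hS _ (hdown η hη _ hle)
    refine lt_of_eq_of_lt ?_ this
    rw [ha, ← integral_const_mul, ← integral_add hgη (g := fun ω => t * -(g ω * (J : Ω →ₘ[P] ℝ) ω)) (hgJ.neg.const_mul t)]
    refine integral_congr_ae ?_
    filter_upwards [hcoe] with ω h
    rw [h]
    ring
  have ha1 : a = 0 := by
    by_contra hne
    have hpos : 0 < a := lt_of_le_of_ne ha0 (Ne.symm hne)
    have h0 := hlt 0 le_rfl
    rw [zero_mul, add_zero] at h0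
    -- For this `t` the pairing equals `s`, contradicting the strict bound.
    have := hlt ((s - ∫ ω, g ω * (η : Ω →ₘ[P] ℝ) ω ∂P) / a) (div_nonneg (by linarith) ha0)
    rw [div_mul_cancel₀ _ hne] at this
    linarith
  have hz := (integral_eq_zero_iff_of_nonneg_ae hnp hgJ.neg).1 ha1
  filter_upwards [hz, hJ] with ω h1 h2
  by_contra hω
  have hω' : g ω < 0 := not_le.1 hω
  rw [h2] at h1
  simp [hω'] at h1
  exact hω'.ne h1

variable [IsProbabilityMeasure P]

/-- On every nonnull `G`-event some agreeing probability is, on a nonnull part of it, almost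
optimal for `X`. -/
theorem exists_almost_optimal (hL : Admissible hm LF LG) (hGF : LG ≤ LF)
    (hone : (1 : Ω →ₘ[P] ℝ) ∈ LG) (hmon : Monotone π) (hreg : IsRegularMap hm π)
    (hcas : IsCashAdditive π) (hqc : IsQuasiconvex mG π) (hlsc : IsWeakLSC π)
    (hne : (dualProb LF ∩ probAgreeing mG P).Nonempty) (X : LF) {ε : ℝ} (hε : 0 < ε)
    {B : Set Ω} (hB : MeasurableSet[mG] B) (hPB : P B ≠ 0) :
    ∃ Q ∈ dualProb LF ∩ probAgreeing mG P, ∃ C ⊆ B, MeasurableSet[mG] C ∧ P C ≠ 0 ∧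
      ∀ ξ : LF, ∀ᵐ ω ∂P, ω ∈ C →
        condE hm Q (ξ : Ω →ₘ[P] ℝ) ω - (π ξ : Ω →ₘ[P] ℝ) ω ≤
          condE hm Q (X : Ω →ₘ[P] ℝ) ω - (π X : Ω →ₘ[P] ℝ) ω + ε := by
  have hind : ∀ (A : Set Ω) (hA : MeasurableSet A), ind P hA ∈ LF := fun A hA => by
    simpa using hL.ind_memF 1 (hGF hone) A hA
  let S : Set LF := {ξ | π ξ ≤ 0}
  have hSmem : ∀ ξ : LF, ξ ∈ S ↔ ∀ᵐ ω ∂P, (π ξ : Ω →ₘ[P] ℝ) ω ≤ 0 := fun ξ => by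
    change (π ξ : Ω →ₘ[P] ℝ) ≤ 0 ↔ _
    rw [← AEEqFun.coeFn_le]
    exact eventually_congr ((AEEqFun.coeFn_zero (α := Ω) (β := ℝ) (μ := P)).mono fun ω h => by
      rw [h, Pi.zero_apply])
  obtain ⟨η, hη⟩ := exists_translate hGF hone hcas 0 0
  have hηS : η ∈ S := (hSmem η).2 (hη.mono fun ω h => h.2.le)
  -- `X₀ = X - π(X) + ε` has `π(X₀) = ε`. Using it only on `B`, with the accepted `η` elsewhere,
  -- gives a rejected `x` and confines the separation to `B`.
  obtain ⟨X₀, hX₀⟩ := exists_translate hGF hone hcas X ε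
  obtain ⟨x, hx⟩ := exists_paste hL hreg X₀ η hB
  have hxS : x ∉ S := fun h => hPB <| by
    rw [measure_eq_zero_iff_ae_notMem]
    filter_upwards [(hSmem x).1 h, hX₀, hx] with ω h1 h2 h3 hω
    rw [(h3.1 hω).2, h2.2] at h1
    exact absurd h1 (not_le.2 hε)
  obtain ⟨g, hg, s, hgS, hgx⟩ := exists_separating_density (convex_acceptance hqc) (hlsc 0) hxS
  have g_nonneg : ∀ᵐ ω ∂P, 0 ≤ g ω := nonneg_of_bounded_above hg
    (fun ξ hξ ζ hζ => (hmon hζ).trans hξ) ⟨η, hηS⟩ hind hgS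
  have hpaste : ∀ ξ ∈ S, ∀ η ∈ S, ∀ A, MeasurableSet[mG] A → ∃ ζ ∈ S, ∀ᵐ ω ∂P,
      (ω ∈ A → (ζ : Ω →ₘ[P] ℝ) ω = (ξ : Ω →ₘ[P] ℝ) ω) ∧
      (ω ∉ A → (ζ : Ω →ₘ[P] ℝ) ω = (η : Ω →ₘ[P] ℝ) ω) := by
    intro ξ hξ η hη A hA
    obtain ⟨ζ, hζ⟩ := exists_paste hL hreg ξ η hA
    refine ⟨ζ, (hSmem ζ).2 ?_, hζ.mono fun ω h => ⟨fun hω => (h.1 hω).1, fun hω => (h.2 hω).1⟩⟩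
    filter_upwards [(hSmem ξ).1 hξ, (hSmem η).1 hη, hζ] with ω h1 h2 h3
    by_cases hω : ω ∈ A
    · rwa [(h3.1 hω).2]
    · rwa [(h3.2 hω).2]
  obtain ⟨C, hC, hPC, hsep⟩ := exists_separating_event hm hg hpaste ⟨η, hηS⟩ hgS hgx
  set γ := condExp mG P g with hγdef
  have hγm : Measurable[mG] γ := stronglyMeasurable_condExp.measurable
  have hgi : Integrable g P := (mem_orderDual_iff.1 hg).1
  have hgL : ∀ ξ : LF, Integrable (fun ω => g ω * (ξ : Ω →ₘ[P] ℝ) ω) P := fun ξ =>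
    integrable_mul_of_mem_orderDual hg ξ.2
  -- Off `B` the points `x` and `η ∈ S` coincide, so they cannot be strictly separated there. The
  -- same happens on `{γ = 0}`, where `g` vanishes.
  have hCB : ∀ᵐ ω ∂P, ω ∈ C → ω ∈ B := by
    have h1 := condExp_congr_on (hgL x) (hgL η) hB.compl
      (hx.mono fun ω h hω => by rw [(h.2 hω).1])
    filter_upwards [h1, hsep η hηS] with ω h1 h2 hω
    by_contra hωB
    exact (h2 hω).ne (h1 hωB).symm
  have hγ0 : 0 ≤ᵐ[P] γ := condExp_nonneg g_nonneg
  have hCγ : ∀ᵐ ω ∂P, ω ∈ C → 0 < γ ω := by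
    have hZ : MeasurableSet[mG] {ω | γ ω = 0} := hγm (measurableSet_singleton 0)
    have h1 := condExp_congr_on (hgL x) (hgL η) hZ
      ((ae_eq_zero_of_condExp_eq_zero hm hgi g_nonneg).mono fun ω h hω => by
        rw [h hω, zero_mul, zero_mul])
    filter_upwards [h1, hsep η hηS, hγ0] with ω h1 h2 h3 hω
    refine lt_of_le_of_ne h3 fun h => ?_
    exact (h2 hω).ne (h1 h.symm).symm
  obtain ⟨n, hn⟩ : ∃ n : ℕ, P (C ∩ B ∩ {ω | 1 / ((n : ℝ) + 1) ≤ γ ω}) ≠ 0 := by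
    by_contra! hall
    refine hPC ?_
    rw [measure_eq_zero_iff_ae_notMem]
    have h : ∀ᵐ ω ∂P, ∀ n : ℕ, ω ∉ C ∩ B ∩ {ω | 1 / ((n : ℝ) + 1) ≤ γ ω} :=
      ae_all_iff.2 fun n => measure_eq_zero_iff_ae_notMem.1 (hall n)
    filter_upwards [h, hCB, hCγ] with ω h1 h2 h3 hω
    obtain ⟨n, hn⟩ := exists_nat_one_div_lt (h3 hω)
    exact h1 n ⟨⟨hω, h2 hω⟩, hn.le⟩
  set C' := C ∩ B ∩ {ω | 1 / ((n : ℝ) + 1) ≤ γ ω} with hC'def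
  have hC' : MeasurableSet[mG] C' := (hC.inter hB).inter (hγm measurableSet_Ici)
  obtain ⟨Q₀, hQ₀⟩ := hne
  obtain ⟨Q, hQ, hQE⟩ := exists_normalized hm hg g_nonneg hQ₀ hC'
    (Nat.one_div_pos_of_nat (n := n)) fun ω hω => hω.2
  have hdi : Integrable (density P Q) P := (mem_orderDual_iff.1 hQ.1.2.2).1
  have hQL : ∀ ξ : LF, Integrable (fun ω => density P Q ω * (ξ : Ω →ₘ[P] ℝ) ω) P := fun ξ =>
    integrable_mul_of_mem_orderDual hQ.1.2.2 ξ.2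
  have htrans : ∀ (ξ Z : LF) (c : ℝ), (∀ᵐ ω ∂P, (Z : Ω →ₘ[P] ℝ) ω =
      (ξ : Ω →ₘ[P] ℝ) ω + (c - (π ξ : Ω →ₘ[P] ℝ) ω)) → ∀ᵐ ω ∂P,
      condE hm Q (Z : Ω →ₘ[P] ℝ) ω =
        condE hm Q (ξ : Ω →ₘ[P] ℝ) ω + (c - (π ξ : Ω →ₘ[P] ℝ) ω) := by
    intro ξ Z c hZ
    have hΛ : ((Z - ξ : LF) : Ω →ₘ[P] ℝ) =ᵐ[P] fun ω => c - (π ξ : Ω →ₘ[P] ℝ) ω := by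
      filter_upwards [AEEqFun.coeFn_sub (Z : Ω →ₘ[P] ℝ) ξ, hZ] with ω h1 h2
      rw [Submodule.coe_sub, h1, Pi.sub_apply, h2]
      ring
    have hΛm : AEStronglyMeasurable[mG] ((Z - ξ : LF) : Ω →ₘ[P] ℝ) P :=
      (aestronglyMeasurable_const.sub (hL.measurableG _ (π ξ).2)).congr hΛ.symm
    have hZ' : (Z : Ω →ₘ[P] ℝ) = ξ + (Z - ξ : LF) := by
      rw [Submodule.coe_sub, add_sub_cancel]
    have h := condE_add hm hQ.2 (hQL ξ) (hQL (Z - ξ))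
    rw [← hZ'] at h
    filter_upwards [h, condE_of_measurable hm hQ.2 hdi hΛm (hQL _), hΛ] with ω h1 h2 h3
    rw [h1, h2, h3]
  refine ⟨Q, hQ, C', fun ω hω => hω.1.2, hC', hn, fun ξ => ?_⟩
  -- `ζ = ξ - π(ξ)` is accepted; dividing its separation from `X₀` by `γ > 0` compares `E_Q[ξ|G] -
  -- π(ξ)` with `E_Q[X|G] - π(X) + ε`.
  obtain ⟨ζ, hζ⟩ := exists_translate hGF hone hcas ξ 0
  have hζS : ζ ∈ S := (hSmem ζ).2 (hζ.mono fun ω h => h.2.le)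
  have hxX₀ := condExp_congr_on (hgL x) (hgL X₀) hB (hx.mono fun ω h hω => by rw [(h.1 hω).1])
  filter_upwards [hsep ζ hζS, hxX₀, hCγ, hQE _ ζ.2, hQE _ X₀.2,
    htrans ξ ζ 0 (hζ.mono fun ω h => h.1), htrans X X₀ ε (hX₀.mono fun ω h => h.1)]
    with ω h1 h2 h3 h4 h5 h6 h7 hω
  have hlt := h1 hω.1.1
  rw [h2 hω.1.2, h4 hω, h5 hω] at hlt
  have := lt_of_mul_lt_mul_left hlt (h3 hω.1.1).le
  rw [h6, h7] at this
  linarith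

theorem conjugate_le_on (hm : mG ≤ mF) (π : LF → LG) (Q : Measure Ω) {C : Set Ω}
    (hC : MeasurableSet C) (W : Ω →ₘ[P] ℝ)
    (h : ∀ ξ : LF, ∀ᵐ ω ∂P, ω ∈ C →
      condE hm Q (ξ : Ω →ₘ[P] ℝ) ω - (π ξ : Ω →ₘ[P] ℝ) ω ≤ W ω) :
    ∀ᵐ ω ∂P, ω ∈ C → conjugate hm π Q ω ≤ (W ω : EReal) := by
  classical
  -- The value `⊤` off `C` turns the local bound into a global one, as the least upper bound
  -- property requires.
  have hmeas : Measurable (C.piecewise (fun ω => (W ω : EReal)) fun _ => ⊤) :=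
    W.measurable.coe_real_ereal.piecewise hC measurable_const
  have hcoe := AEEqFun.coeFn_mk _ (hmeas.aestronglyMeasurable (μ := P))
  have hle := conjugate_le hm π Q (AEEqFun.mk _ (hmeas.aestronglyMeasurable (μ := P))) fun ξ => by
    filter_upwards [h ξ, hcoe] with ω h1 h2
    rw [h2]
    by_cases hω : ω ∈ C
    · rw [Set.piecewise_eq_of_mem _ _ _ hω]
      exact EReal.coe_le_coe_iff.2 (h1 hω)
    · simp [hω]
  filter_upwards [AEEqFun.coeFn_le.2 hle, hcoe] with ω h1 h2 hω
  rw [h2] at h1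
  simpa [hω] using h1

/-- The dual representation of quasiconvex cash additive maps. -/
theorem toExt_map_eq_aeSup (hL : Admissible hm LF LG) (hGF : LG ≤ LF)
    (hone : (1 : Ω →ₘ[P] ℝ) ∈ LG) (hmon : Monotone π) (hreg : IsRegularMap hm π)
    (hcas : IsCashAdditive π) (hqc : IsQuasiconvex mG π) (hlsc : IsWeakLSC π)
    (hne : (dualProb LF ∩ probAgreeing mG P).Nonempty) (X : LF) :
    toExt (π X : Ω →ₘ[P] ℝ) =
      aeSup {Z | ∃ Q ∈ dualProb LF ∩ probAgreeing mG P,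
        Z = extSub (condE hm Q (X : Ω →ₘ[P] ℝ)) (conjugate hm π Q)} := by
  have hlub := isLUB_aeSup {Z | ∃ Q ∈ dualProb LF ∩ probAgreeing mG P,
        Z = extSub (condE hm Q (X : Ω →ₘ[P] ℝ)) (conjugate hm π Q)}
  set W := aeSup {Z | ∃ Q ∈ dualProb LF ∩ probAgreeing mG P,
        Z = extSub (condE hm Q (X : Ω →ₘ[P] ℝ)) (conjugate hm π Q)}
  refine le_antisymm ?_ (hlub.2 ?_)
  · have key : ∀ ε : ℝ, 0 < ε → ∀ᵐ ω ∂P, (((π X : Ω →ₘ[P] ℝ) ω - ε : ℝ) : EReal) ≤ W ω := by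
      intro ε hε
      have hDm : MeasurableSet {ω | W ω < (((π X : Ω →ₘ[P] ℝ) ω - ε : ℝ) : EReal)} :=
        measurableSet_lt W.measurable
          ((π X : Ω →ₘ[P] ℝ).measurable.sub_const ε).coe_real_ereal
      set D := {ω | W ω < (((π X : Ω →ₘ[P] ℝ) ω - ε : ℝ) : EReal)} with hD
      let φ : Ω → ℝ := D.indicator fun _ => 1
      have hφi : Integrable φ P := (integrable_const 1).indicator hDm
      have hφ0 : 0 ≤ᵐ[P] φ := ae_of_all _ fun ω => Set.indicator_nonneg
        (fun _ _ => zero_le_one) ω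
      -- `W` is only known to be `F`-measurable, so `D` need not be a `G`-event; this `G`-event
      -- contains `D` almost surely.
      have hBm : MeasurableSet[mG] {ω | 0 < condExp mG P φ ω} :=
        stronglyMeasurable_condExp.measurable measurableSet_Ioi
      have hB : P {ω | 0 < condExp mG P φ ω} = 0 := by
        by_contra hPB
        obtain ⟨Q, hQ, C, hCB, hC, hPC, hopt⟩ := exists_almost_optimal hL hGF hone hmon hreg hcas
          hqc hlsc hne X hε hBm hPB
        let V : Ω →ₘ[P] ℝ := AEEqFun.mk
          (fun ω => condE hm Q (X : Ω →ₘ[P] ℝ) ω - (π X : Ω →ₘ[P] ℝ) ω + ε)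
          (((AEEqFun.aestronglyMeasurable _).sub (AEEqFun.aestronglyMeasurable _)).add
            aestronglyMeasurable_const)
        have hV : V =ᵐ[P] fun ω =>
            condE hm Q (X : Ω →ₘ[P] ℝ) ω - (π X : Ω →ₘ[P] ℝ) ω + ε := AEEqFun.coeFn_mk _ _
        have hconj := conjugate_le_on hm π Q (hm C hC) V fun ξ => by
          filter_upwards [hopt ξ, hV] with ω h1 h2 hω
          rw [h2]
          exact h1 hω
        -- On `C` the value at `Q` is at least `π(X) - ε`, so `C` misses `D`. Then `E_P[1_D|G] = 0`
        -- on `C`, although `C` lies where it is positive.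
        have hnot : ∀ᵐ ω ∂P, ω ∈ C → φ ω = 0 := by
          filter_upwards [hconj, hV, AEEqFun.coeFn_le.2 (hlub.1 ⟨Q, hQ, rfl⟩),
            coeFn_extSub (condE hm Q (X : Ω →ₘ[P] ℝ)) (conjugate hm π Q)] with ω h1 h2 h3 h4 hω
          have h5 := h1 hω
          rw [h2] at h5
          rw [h4] at h3
          have h6 : ω ∉ D := by
            rw [hD, Set.mem_ofPred_eq, not_lt]
            refine le_trans (le_of_eq ?_) ((EReal.sub_le_sub le_rfl h5).trans h3)
            norm_cast
            ring
          simp [φ, h6]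
        refine hPC ?_
        rw [measure_eq_zero_iff_ae_notMem]
        filter_upwards [condExp_congr_on (g := 0) hφi (integrable_zero Ω ℝ P) hC hnot] with ω h1 hω
        have h2 : 0 < condExp mG P φ ω := hCB hω
        rw [h1 hω] at h2
        rw [condExp_zero] at h2
        exact lt_irrefl _ h2
      filter_upwards [ae_eq_zero_of_condExp_eq_zero hm hφi hφ0,
        measure_eq_zero_iff_ae_notMem.1 hB, condExp_nonneg (m := mG) hφ0] with ω h1 h2 h3
      have h4 := h1 (le_antisymm (not_lt.1 h2) h3)
      by_contra hω
      have h5 : ω ∈ D := not_le.1 hω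
      simp [φ, h5] at h4
    have hall : ∀ᵐ ω ∂P, ∀ n : ℕ,
        (((π X : Ω →ₘ[P] ℝ) ω - 1 / ((n : ℝ) + 1) : ℝ) : EReal) ≤ W ω :=
      ae_all_iff.2 fun n => key _ Nat.one_div_pos_of_nat
    rw [← AEEqFun.coeFn_le]
    filter_upwards [hall, coeFn_toExt (π X : Ω →ₘ[P] ℝ)] with ω h1 h2
    rw [h2]
    have hlim : Tendsto (fun n : ℕ => (π X : Ω →ₘ[P] ℝ) ω - 1 / ((n : ℝ) + 1)) atTop
        (𝓝 ((π X : Ω →ₘ[P] ℝ) ω)) := by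
      simpa only [sub_zero] using
        (tendsto_const_nhds (x := (π X : Ω →ₘ[P] ℝ) ω)).sub
          (tendsto_one_div_add_atTop_nhds_zero_nat (𝕜 := ℝ))
    exact le_of_tendsto' ((continuous_coe_real_ereal.tendsto _).comp hlim) h1
  · rintro _ ⟨Q, hQ, rfl⟩
    rw [← AEEqFun.coeFn_le]
    filter_upwards [toExt_le_conjugate hm π Q X, coeFn_toExt (π X : Ω →ₘ[P] ℝ),
      coeFn_extSub (condE hm Q (X : Ω →ₘ[P] ℝ)) (conjugate hm π Q)] with ω h1 h2 h3
    rw [h2, h3]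
    refine (EReal.sub_le_sub le_rfl h1).trans (le_of_eq ?_)
    norm_cast
    ring

end Duality

end CondQuasiconvex

open CondQuasiconvex in
theorem mainTheorem3 {Ω : Type u} {mG mF : MeasurableSpace Ω} (hm : mG ≤ mF)
    (P : Measure Ω) [IsProbabilityMeasure P]
    (LF LG : Submodule ℝ (Ω →ₘ[P] ℝ)) (hL : Admissible hm LF LG)
    (hGF : LG ≤ LF) (hone : (1 : Ω →ₘ[P] ℝ) ∈ LG)
    (hE : ∀ Q ∈ dualProb LF ∩ probAgreeing mG P, ∀ ξ ∈ LF, condE hm Q ξ ∈ LF)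
    (π : LF → LG) (hmon : Monotone π) (hreg : IsRegularMap hm π) (hcas : IsCashAdditive π) :
    (∀ Q ∈ dualProb LF ∩ probAgreeing mG P, ∀ X : LF,
      K mG π X Q = extSub (condE hm Q (X : Ω →ₘ[P] ℝ)) (conjugate hm π Q)) ∧
    (IsQuasiconvex mG π → IsWeakLSC π → (dualProb LF ∩ probAgreeing mG P).Nonempty →
      ∀ X : LF, toExt (π X : Ω →ₘ[P] ℝ) =
        aeSup {Z | ∃ Q ∈ dualProb LF ∩ probAgreeing mG P,
          Z = extSub (condE hm Q (X : Ω →ₘ[P] ℝ)) (conjugate hm π Q)}) := by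
  exact ⟨fun Q hQ X => K_eq_extSub hL hGF hone hmon hreg hcas hQ (hE Q hQ) X,
    fun hqc hlsc hne X => toExt_map_eq_aeSup hL hGF hone hmon hreg hcas hqc hlsc hne X⟩
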